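/- Let $M\ge 1$ be an integer, $\lambda>0$, and let $S\ge 0$ be a (finite) real random variable; put $P_\lambda=\mathbb{E}(e^{-\lambda S})$. Consider the following $M$-stream M/G/1/1 queue with preemption. Starting with an empty system at time $0$, updates are generated at the points of a Poisson process with rate $\lambda$. Each update belongs to stream $i\in\{1,\dots,M\}$ with probability $p_i$, where $p_i\ge 0$ and $\sum_i p_i=1$, and has a service time distributed as $S$; interarrival times, stream choices and service times are all independent. There is no buffer: each new update immediately enters service and preempts (discards) the update in service, of whatever stream, if there is one. An update is received at the end of its service if this happens before the next update is generated. The age of stream $i$ at time $t$ is $\Delta_i(t)=t-u_i(t)$, where $u_i(t)$ is the generation time of the last update of stream $i$ received up to time $t$ (and $u_i(t)=0$ if there is none). Let $K_{i,j}$ be the age of stream $i$ immediately before its $j$-th received update is received ($K_{i,j}=\infty$ if fewer than $j$ updates of stream $i$ are ever received). The average age and the average peak age of stream $i$ are the almost sure limits $$\Delta_i=\lim_{\tau\to\infty}\frac1\tau\int_0^\tau\Delta_i(t)\,dt,\qquad \Delta_{peak,i}=\lim_{N\to\infty}\frac1N\sum_{j=1}^N K_{i,j}.$$ Then, for every $(p_1,\dots,p_M)$,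 these limits exist in $[0,\infty]$ almost surely and are deterministic numbers that depend only on $M$, $\lambda$, the law of $S$ and $(p_1,\dots,p_M)$. With $M$, $\lambda$ and the law of $S$ fixed, each of the totals $\Delta_{tot}=\sum_{i=1}^M\Delta_i$ and $\Delta_{peak,tot}=\sum_{i=1}^M\Delta_{peak,i}$, as a function of the probability vector $(p_1,\dots,p_M)$, is minimized at the uniform distribution $p_i=1/M$, $i=1,\dots,M$, and only there. The minimal values are $$\Delta_{tot}=\frac{M^2}{\lambda P_\lambda},\qquad \Delta_{peak,tot}=\frac{M^2}{\lambda P_\lambda}+\frac{M\,\mathbb{E}(Se^{-\lambda S})}{P_\lambda}.$$ -/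

import Mathlib

open MeasureTheory ProbabilityTheory Filter Topology
open scoped ENNReal

noncomputable section

namespace PreemptiveQueue

/-- The law of the stream label of an update: stream `i` is chosen with probability `p i`. -/
def streamLaw {M : ℕ} (p : Fin M → ℝ) : Measure (Fin M) :=
  ∑ i, ENNReal.ofReal (p i) • Measure.dirac i

/-- The random input of the queue. Updates are numbered `0, 1, 2, …` in the order of their
generation; `X n` is the time between the generation of update `n - 1` (the time origin, if
`n = 0`) and that of update `n`, `S n` is the service time of update `n` and `L n` is its stream.
The triples `(X n, S n, L n)` are independent and identically distributed with independent
components, `X n` being exponential with rate `lam` (so that the generation times form a Poisson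
process with rate `lam`), `S n` having the law `ν`, and `L n = i` having probability `p i`. -/
structure IsInput {Ω : Type*} [MeasurableSpace Ω] (μ : Measure Ω) {M : ℕ} (lam : ℝ)
    (ν : Measure ℝ) (p : Fin M → ℝ) (X S : ℕ → Ω → ℝ) (L : ℕ → Ω → Fin M) : Prop where
  hasLaw : ∀ n, HasLaw (fun ω => (X n ω, S n ω, L n ω))
    ((expMeasure lam).prod (ν.prod (streamLaw p))) μ
  indep : iIndepFun (fun n ω => (X n ω, S n ω, L n ω)) μ

/-- Realizations of the input exist. -/
theorem exists_isInput {M : ℕ} {lam : ℝ} (hlam : 0 < lam) (ν : Measure ℝ)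
    [IsProbabilityMeasure ν] {p : Fin M → ℝ} (hp : p ∈ stdSimplex ℝ (Fin M)) :
    ∃ (Ω : Type) (_ : MeasurableSpace Ω) (μ : Measure Ω) (X S : ℕ → Ω → ℝ) (L : ℕ → Ω → Fin M),
      IsProbabilityMeasure μ ∧ IsInput μ lam ν p X S L := by
  have := isProbabilityMeasure_expMeasure hlam
  have : IsProbabilityMeasure (streamLaw p) := ⟨by
    simp only [streamLaw, Measure.coe_finsetSum, Finset.sum_apply, Measure.smul_apply,
      measure_univ, smul_eq_mul, mul_one]
    rw [← ENNReal.ofReal_sum_of_nonneg fun i _ => hp.1 i, hp.2, ENNReal.ofReal_one]⟩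
  let ρ := (expMeasure lam).prod (ν.prod (streamLaw p))
  refine ⟨ℕ → ℝ × ℝ × Fin M, inferInstance, Measure.infinitePi fun _ => ρ,
    fun n ω => (ω n).1, fun n ω => (ω n).2.1, fun n ω => (ω n).2.2, inferInstance, ?_, ?_⟩
  · exact fun n => (measurePreserving_eval_infinitePi (fun _ => ρ) n).hasLaw
  · exact iIndepFun_infinitePi (P := fun _ : ℕ => ρ) (X := fun _ z => z) fun _ => measurable_id

/-! The queue on one sample path: `x`, `s`, `l` are the sequences of the interarrival times, the
service times and the streams. -/

/-- The generation time of update `n`. -/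
def genTime (x : ℕ → ℝ) (n : ℕ) : ℝ := ∑ k ∈ Finset.range (n + 1), x k

/-- The time at which update `n` leaves the server if it is not preempted: there is no buffer, and
every update enters service at once, preempting whatever is being served. -/
def recTime (x s : ℕ → ℝ) (n : ℕ) : ℝ := genTime x n + s n

/-- The successfully received updates of stream `i`: those of stream `i` whose service ends before
the next update, of any stream, is generated. -/
def received {M : ℕ} (x s : ℕ → ℝ) (l : ℕ → Fin M) (i : Fin M) : Set ℕ :=
  {n | l n = i ∧ recTime x s n < genTime x (n + 1)}

/-- The age of stream `i` at time `t`, that is `t - u` with `u` the generation time of the most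
recent update of stream `i` that was received up to time `t`, and `u = 0` if there is none. -/
def age {M : ℕ} (x s : ℕ → ℝ) (l : ℕ → Fin M) (i : Fin M) (t : ℝ) : ℝ :=
  t - sSup (insert 0 (genTime x '' {n ∈ received x s l i | recTime x s n ≤ t}))

/-- The age of stream `i` immediately before time `t`: only the updates received strictly before
`t` count. -/
def ageBefore {M : ℕ} (x s : ℕ → ℝ) (l : ℕ → Fin M) (i : Fin M) (t : ℝ) : ℝ :=
  t - sSup (insert 0 (genTime x '' {n ∈ received x s l i | recTime x s n < t}))

open Classical in
/-- The peak age of stream `i` immediately before its reception number `j` (`j = 0, 1, …`). If there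
are at most `j` receptions, the age grows without bound after the last one, and the value is `∞`. -/
def peakAge {M : ℕ} (x s : ℕ → ℝ) (l : ℕ → Fin M) (i : Fin M) (j : ℕ) : ℝ≥0∞ :=
  if (j : ℕ∞) < (received x s l i).encard then
    ENNReal.ofReal (ageBefore x s l i (recTime x s (Nat.nth (· ∈ received x s l i) j)))
  else ∞

/-- `a` is the average age of the path: `(1 / τ) ∫₀^τ age(t) dt → a` as `τ → ∞`. -/
def HasAvgAge {M : ℕ} (x s : ℕ → ℝ) (l : ℕ → Fin M) (i : Fin M) (a : ℝ≥0∞) : Prop :=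
  Tendsto (fun τ : ℝ => (∫⁻ t in Set.Ioc 0 τ, ENNReal.ofReal (age x s l i t)) / ENNReal.ofReal τ)
    atTop (𝓝 a)

/-- `a` is the average peak age of the path: `(1 / N) (K₁ + ⋯ + K_N) → a` as `N → ∞`. -/
def HasAvgPeakAge {M : ℕ} (x s : ℕ → ℝ) (l : ℕ → Fin M) (i : Fin M) (a : ℝ≥0∞) : Prop :=
  Tendsto (fun N : ℕ => (∑ j ∈ Finset.range N, peakAge x s l i j) / (N : ℝ≥0∞)) atTop (𝓝 a)

end PreemptiveQueue

end

/-! Fix a stream `i`, let `P` be the integral of `exp (-lam * s)` against `ν`, and put `q = p i *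
P`. Let `A n` be the age of stream `i` when update `n` is generated, and `R n` the indicator that
update `n` is a received update of stream `i`. Then `A (n + 1) = (1 - R n) * A n + X (n + 1)`. Here
`R n` depends only on `(X (n + 1), S n, L n)`, which is independent of everything that determines `A
n`, and it has mean `q`.

Summing the recursion gives average `1 / lam` for `R n * A n`, because `A N / N` tends to zero. By
the law of large numbers for orthogonal terms (`ae_tendsto_average_mul_mark`) `R n` may be replaced
by `q`, so `A n` has average `1 / (lam * q)`. No renewal or ergodic theory is needed, only bounded
second moments of `A n` (`exists_bound_arrivalAge`).

The area under the age between two generations is `X (n + 1) ^ 2 / 2 + A n * hold`, where `hold` has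
mean `(1 - q) / lam` by memorylessness. Hence the area per update is `1 / (lam ^ 2 * q)`, and the
average age is `1 / (lam * q)`. The peak age at a reception is `A n + S n`; averaging over
receptions adds the mean service time of received updates, which does not depend on `i`. If `p i =
0`, nothing of stream `i` is received and both averages are infinite.

Both totals therefore have the form `∑ i, (1 / (c * p i) + d)`, and completing the square
(`sum_streamCost`) shows that the uniform vector is their only minimizer. -/

noncomputable section

namespace PreemptiveQueue

/-! ### A strong law of large numbers from orthogonality -/

section LawOfLargeNumbers

variable {Ω : Type*} [MeasurableSpace Ω] {μ : Measure Ω}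

/-- Nonnegative functions with summable integrals tend to zero almost everywhere. -/
theorem ae_tendsto_zero_of_summable_integral {f : ℕ → Ω → ℝ} (hf : ∀ n, Integrable (f n) μ)
    (h0 : ∀ n ω, 0 ≤ f n ω) {c : ℕ → ℝ} (hc : ∀ n, ∫ ω, f n ω ∂μ ≤ c n) (hs : Summable c) :
    ∀ᵐ ω ∂μ, Tendsto (fun n => f n ω) atTop (𝓝 0) := by
  -- By Tonelli the sum of the functions has a finite integral, so it is finite almost everywhere
  -- and its terms tend to zero.
  have hfin : ∫⁻ ω, ∑' n, ENNReal.ofReal (f n ω) ∂μ ≠ ∞ := by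
    rw [lintegral_tsum fun n => (hf n).aemeasurable.ennreal_ofReal]
    refine ne_top_of_le_ne_top hs.tsum_ofReal_ne_top (ENNReal.tsum_le_tsum fun n => ?_)
    rw [← ofReal_integral_eq_lintegral_ofReal (hf n) (ae_of_all _ (h0 n))]
    exact ENNReal.ofReal_le_ofReal (hc n)
  have hlt := ae_lt_top' (AEMeasurable.tsum fun n => (hf n).aemeasurable.ennreal_ofReal) hfin
  filter_upwards [hlt] with ω hω
  have h := ENNReal.tendsto_atTop_zero_of_tsum_ne_top hω.ne
  have h' := (ENNReal.tendsto_toReal ENNReal.zero_ne_top).comp h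
  simpa [Function.comp_def, ENNReal.toReal_ofReal (h0 _ _)] using h'

/-- The second moment of a sum of orthogonal functions. -/
theorem integral_sq_sum_le_of_orthogonal {Z : ℕ → Ω → ℝ} (hZ : ∀ n, MemLp (Z n) 2 μ)
    (horth : ∀ m n, m < n → ∫ ω, Z m ω * Z n ω ∂μ = 0) {C : ℝ}
    (hC : ∀ n, ∫ ω, Z n ω ^ 2 ∂μ ≤ C) (N : ℕ) :
    ∫ ω, (∑ n ∈ Finset.range N, Z n ω) ^ 2 ∂μ ≤ C * N := by
  induction N with
  | zero => simp
  | succ N ih =>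
    have hS : MemLp (fun ω => ∑ n ∈ Finset.range N, Z n ω) 2 μ :=
      memLp_finsetSum _ fun n _ => hZ n
    have hcross : ∫ ω, (∑ n ∈ Finset.range N, Z n ω) * Z N ω ∂μ = 0 := by
      simp_rw [Finset.sum_mul]
      rw [integral_finsetSum (f := fun n ω => Z n ω * Z N ω) _
        fun n _ => (hZ n).integrable_mul (hZ N)]
      exact Finset.sum_eq_zero fun n hn => horth n N (Finset.mem_range.1 hn)
    have hexp : ∀ ω, (∑ n ∈ Finset.range (N + 1), Z n ω) ^ 2 =
        (∑ n ∈ Finset.range N, Z n ω) ^ 2 + (2 * ((∑ n ∈ Finset.range N, Z n ω) * Z N ω) +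
          Z N ω ^ 2) := fun ω => by rw [Finset.sum_range_succ]; ring
    simp_rw [hexp]
    have hi := (hS.integrable_mul (hZ N)).const_mul 2
    have e1 := integral_add hS.integrable_sq (hi.add (hZ N).integrable_sq)
    have e2 := integral_add hi (hZ N).integrable_sq
    simp only [Pi.add_apply, Pi.mul_apply] at e1 e2
    rw [e1, e2, integral_const_mul, hcross]
    push_cast
    linarith [hC N]

/-- A strong law of large numbers for orthogonal functions with bounded second moments. -/
theorem ae_tendsto_average_zero_of_orthogonal {Z : ℕ → Ω → ℝ} (hZ : ∀ n, MemLp (Z n) 2 μ)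
    (horth : ∀ m n, m < n → ∫ ω, Z m ω * Z n ω ∂μ = 0) {C : ℝ}
    (hC : ∀ n, ∫ ω, Z n ω ^ 2 ∂μ ≤ C) :
    ∀ᵐ ω ∂μ, Tendsto (fun N : ℕ => (∑ n ∈ Finset.range N, Z n ω) / N) atTop (𝓝 0) := by
  have hC0 : 0 ≤ C := (integral_nonneg fun ω => sq_nonneg _).trans (hC 0)
  have hS : ∀ N : ℕ, MemLp (fun ω => ∑ n ∈ Finset.range N, Z n ω) 2 μ := fun N =>
    memLp_finsetSum _ fun n _ => hZ n
  -- One majorant serves both estimates. The factor 9 is needed for the second: a block between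
  -- consecutive squares has `2 * n + 1 ≤ 3 * n` terms, and Cauchy–Schwarz bounds its second moment
  -- by `(3 * n) ^ 2 * C`.
  have hsum : Summable fun n : ℕ => 9 * C * (1 / (n : ℝ) ^ 2) :=
    (Real.summable_one_div_nat_pow.2 one_lt_two).mul_left _
  -- the partial sums along the squares
  have h1 : ∀ᵐ ω ∂μ, Tendsto (fun n : ℕ =>
      ((∑ k ∈ Finset.range (n ^ 2), Z k ω) ^ 2) / (n : ℝ) ^ 4) atTop (𝓝 0) := by
    refine ae_tendsto_zero_of_summable_integral (c := fun n : ℕ => 9 * C * (1 / (n : ℝ) ^ 2))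
      (fun n => (hS _).integrable_sq.div_const _) (fun n ω => by positivity) (fun n => ?_) hsum
    rw [integral_div]
    rcases Nat.eq_zero_or_pos n with rfl | hn
    · simp
    have hn' : (0 : ℝ) < n := by exact_mod_cast hn
    have h := integral_sq_sum_le_of_orthogonal hZ horth hC (n ^ 2)
    push_cast at h
    rw [div_le_iff₀ (by positivity)]
    calc _ ≤ C * (n : ℝ) ^ 2 := h
      _ ≤ 9 * C * (n : ℝ) ^ 2 := by nlinarith [mul_nonneg hC0 (sq_nonneg (n : ℝ))]
      _ = _ := by field_simp
  -- the oscillation between consecutive squares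
  have h2 : ∀ᵐ ω ∂μ, Tendsto (fun n : ℕ =>
      ((∑ k ∈ Finset.Ico (n ^ 2) ((n + 1) ^ 2), |Z k ω|) ^ 2) / (n : ℝ) ^ 4) atTop (𝓝 0) := by
    refine ae_tendsto_zero_of_summable_integral (c := fun n : ℕ => 9 * C * (1 / (n : ℝ) ^ 2))
      (fun n => (memLp_finsetSum (f := fun k ω => |Z k ω|) _
        fun k _ => (hZ k).abs).integrable_sq.div_const _)
      (fun n ω => by positivity) (fun n => ?_) hsum
    rw [integral_div]
    rcases Nat.eq_zero_or_pos n with rfl | hn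
    · simp
    have hn' : (1 : ℝ) ≤ n := by exact_mod_cast hn
    have hcard : ((Finset.Ico (n ^ 2) ((n + 1) ^ 2)).card : ℝ) = 2 * n + 1 := by
      rw [Nat.card_Ico, Nat.cast_sub (Nat.pow_le_pow_left (Nat.le_succ n) 2)]
      push_cast; ring
    have hle : ∫ ω, (∑ k ∈ Finset.Ico (n ^ 2) ((n + 1) ^ 2), |Z k ω|) ^ 2 ∂μ ≤
        (2 * n + 1) * ((2 * n + 1) * C) := by
      calc _ ≤ ∫ ω, (2 * n + 1) * ∑ k ∈ Finset.Ico (n ^ 2) ((n + 1) ^ 2), Z k ω ^ 2 ∂μ := by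
            refine integral_mono (memLp_finsetSum (f := fun k ω => |Z k ω|) _
              fun k _ => (hZ k).abs).integrable_sq
              ((integrable_finsetSum _ fun k _ => (hZ k).integrable_sq).const_mul _) fun ω => ?_
            have := sq_sum_le_card_mul_sum_sq (s := Finset.Ico (n ^ 2) ((n + 1) ^ 2))
              (f := fun k => |Z k ω|)
            simpa only [hcard, sq_abs] using this
        _ ≤ _ := by
            rw [integral_const_mul, integral_finsetSum _ fun k _ => (hZ k).integrable_sq]
            refine mul_le_mul_of_nonneg_left ?_ (by positivity)
            calc _ ≤ ∑ k ∈ Finset.Ico (n ^ 2) ((n + 1) ^ 2), C := Finset.sum_le_sum fun k _ => hC k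
              _ = _ := by rw [Finset.sum_const, nsmul_eq_mul, hcard]
    rw [div_le_iff₀ (by positivity)]
    calc _ ≤ _ := hle
      _ ≤ (3 * n) * ((3 * n) * C) := by gcongr <;> linarith
      _ = _ := by field_simp; ring
  have key : ∀ s : ℕ → ℝ, Tendsto (fun n : ℕ => s n ^ 2 / (n : ℝ) ^ 4) atTop (𝓝 0) →
      Tendsto (fun n : ℕ => |s n| / (n : ℝ) ^ 2) atTop (𝓝 0) := by
    intro s hs
    have h := hs.sqrt
    rw [Real.sqrt_zero] at h
    refine h.congr fun n => ?_
    rw [show s n ^ 2 / (n : ℝ) ^ 4 = (s n / (n : ℝ) ^ 2) ^ 2 by ring, Real.sqrt_sq_eq_abs, abs_div,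
      abs_of_nonneg (sq_nonneg (n : ℝ))]
  filter_upwards [h1, h2] with ω hω1 hω2
  have h3 := (key _ hω1).add (key _ hω2)
  rw [add_zero] at h3
  have hsqrt : Tendsto Nat.sqrt atTop atTop :=
    tendsto_atTop.2 fun b => (eventually_ge_atTop (b * b)).mono fun k hk => Nat.le_sqrt.2 hk
  refine squeeze_zero_norm' ?_ (h3.comp hsqrt)
  filter_upwards [eventually_ge_atTop 1] with k hk
  -- The sum up to `k` is the sum up to the largest square `n ^ 2 ≤ k` plus part of one block, and
  -- dividing by `k` instead of `n ^ 2` only decreases the quotient.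
  set n := Nat.sqrt k with hn
  have hn1 : n ^ 2 ≤ k := by rw [hn, sq]; exact Nat.sqrt_le k
  have hn2 : k < (n + 1) ^ 2 := by rw [hn, sq]; exact Nat.lt_succ_sqrt k
  have hn0 : 0 < n := Nat.sqrt_pos.2 hk
  have hn0' : (0 : ℝ) < n := by exact_mod_cast hn0
  have hdec : ∑ j ∈ Finset.range k, Z j ω =
      ∑ j ∈ Finset.range (n ^ 2), Z j ω + ∑ j ∈ Finset.Ico (n ^ 2) k, Z j ω :=
    (Finset.sum_range_add_sum_Ico _ hn1).symm
  have hosc : |∑ j ∈ Finset.Ico (n ^ 2) k, Z j ω| ≤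
      |(∑ j ∈ Finset.Ico (n ^ 2) ((n + 1) ^ 2), |Z j ω| )| := by
    refine (Finset.abs_sum_le_sum_abs _ _).trans (le_trans ?_ (le_abs_self _))
    exact Finset.sum_le_sum_of_subset_of_nonneg (Finset.Ico_subset_Ico_right hn2.le)
      fun _ _ _ => abs_nonneg _
  have hkn : (n : ℝ) ^ 2 ≤ k := by exact_mod_cast hn1
  simp only [Function.comp_apply, Real.norm_eq_abs]
  rw [abs_div, Nat.abs_cast, ← add_div]
  refine div_le_div₀ (by positivity) ?_ (by positivity) hkn
  rw [hdec]
  exact (abs_add_le _ _).trans (add_le_add_right hosc _)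

end LawOfLargeNumbers

/-! ### Deterministic analysis of one sample path -/

section SamplePath

variable {M : ℕ}

/-- The indicator that an update of stream `y.2.2` and service time `y.2.1`, followed by an
interarrival time `y.1`, is a received update of stream `i`. -/
def success (i : Fin M) (y : ℝ × ℝ × Fin M) : ℝ :=
  if y.2.2 = i ∧ y.2.1 < y.1 then 1 else 0

/-- The time that an update spends in the system if it is a received update of stream `i`, and the
following interarrival time otherwise. -/
def hold (i : Fin M) (y : ℝ × ℝ × Fin M) : ℝ :=
  y.1 - success i y * (y.1 - y.2.1)

/-- The service time and the stream of update `n`, together with the interarrival time that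
follows it. -/
def mark (x s : ℕ → ℝ) (l : ℕ → Fin M) (n : ℕ) : ℝ × ℝ × Fin M := (x (n + 1), s n, l n)

/-- The age of stream `i` at the generation time of update `n`. -/
def arrivalAge (x s : ℕ → ℝ) (l : ℕ → Fin M) (i : Fin M) : ℕ → ℝ
  | 0 => x 0
  | n + 1 => (1 - success i (mark x s l n)) * arrivalAge x s l i n + x (n + 1)

theorem success_nonneg (i : Fin M) (y : ℝ × ℝ × Fin M) : 0 ≤ success i y := by
  unfold success; split_ifs <;> norm_num

theorem success_le_one (i : Fin M) (y : ℝ × ℝ × Fin M) : success i y ≤ 1 := by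
  unfold success; split_ifs <;> norm_num

theorem success_sq (i : Fin M) (y : ℝ × ℝ × Fin M) : success i y ^ 2 = success i y := by
  unfold success; split_ifs <;> norm_num

variable {x s : ℕ → ℝ} {l : ℕ → Fin M} {i : Fin M}

theorem genTime_zero (x : ℕ → ℝ) : genTime x 0 = x 0 := by simp [genTime]

theorem genTime_succ (x : ℕ → ℝ) (n : ℕ) : genTime x (n + 1) = genTime x n + x (n + 1) := by
  simp [genTime, Finset.sum_range_succ]

theorem mem_received {n : ℕ} : n ∈ received x s l i ↔ l n = i ∧ s n < x (n + 1) := by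
  simp [received, recTime, genTime_succ]

open Classical in
theorem success_mark (n : ℕ) :
    success i (mark x s l n) = if n ∈ received x s l i then 1 else 0 := by
  simp only [success, mark, mem_received]
  congr

theorem strictMono_genTime (hx : ∀ n, 0 < x n) : StrictMono (genTime x) :=
  strictMono_nat_of_lt_succ fun n => by rw [genTime_succ]; linarith [hx (n + 1)]

theorem genTime_pos (hx : ∀ n, 0 < x n) (n : ℕ) : 0 < genTime x n :=
  Finset.sum_pos (fun _ _ => hx _) (by simp)

theorem arrivalAge_nonneg (hx : ∀ n, 0 < x n) (n : ℕ) : 0 ≤ arrivalAge x s l i n := by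
  induction n with
  | zero => exact (hx 0).le
  | succ n ih =>
    have := success_le_one i (mark x s l n)
    have h := mul_nonneg (sub_nonneg.2 this) ih
    simp only [arrivalAge]
    linarith [hx (n + 1)]

/-- The last update of stream `i` received before update `n` was generated
`arrivalAge x s l i n` before it. -/
theorem isGreatest_genTime_received (hx : ∀ n, 0 < x n) (n : ℕ) :
    IsGreatest (insert 0 (genTime x '' {k ∈ received x s l i | k < n}))
      (genTime x n - arrivalAge x s l i n) := by
  induction n with
  | zero => simp [arrivalAge, genTime_zero]
  | succ n ih =>
    rw [arrivalAge, genTime_succ, success_mark]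
    split_ifs with h
    · have e : genTime x n + x (n + 1) - ((1 - 1) * arrivalAge x s l i n + x (n + 1)) =
        genTime x n := by ring
      rw [e]
      refine ⟨Or.inr ⟨n, ⟨h, Nat.lt_succ_self n⟩, rfl⟩, ?_⟩
      rintro _ (rfl | ⟨k, ⟨-, hk⟩, rfl⟩)
      · exact (genTime_pos hx n).le
      · exact (strictMono_genTime hx).monotone (Nat.lt_succ_iff.1 hk)
    · have e : genTime x n + x (n + 1) - ((1 - 0) * arrivalAge x s l i n + x (n + 1)) =
        genTime x n - arrivalAge x s l i n := by ring
      rw [e]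
      have hset : {k ∈ received x s l i | k < n + 1} = {k ∈ received x s l i | k < n} := by
        ext k
        refine and_congr_right fun hk => ⟨fun h' => ?_, fun h' => h'.trans (Nat.lt_succ_self n)⟩
        refine lt_of_le_of_ne (Nat.lt_succ_iff.1 h') ?_
        rintro rfl
        exact h hk
      rw [hset]
      exact ih

/-- Receptions occur in the order of generation, so conditions on reception times can be traded for
conditions on indices. -/
theorem recTime_lt_of_lt (hx : ∀ n, 0 < x n) {k n : ℕ} (hk : k ∈ received x s l i) (hkn : k < n) :
    recTime x s k < genTime x n :=
  hk.2.trans_le ((strictMono_genTime hx).monotone hkn)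

theorem genTime_le_recTime (hs : ∀ n, 0 ≤ s n) (n : ℕ) : genTime x n ≤ recTime x s n := by
  rw [recTime]; linarith [hs n]

/-- The age between the generation of update `n` and the time at which it may be received. -/
theorem age_eq_of_not_received (hx : ∀ n, 0 < x n) (hs : ∀ n, 0 ≤ s n) {n : ℕ} {t : ℝ}
    (h1 : genTime x n ≤ t) (h2 : t < genTime x (n + 1))
    (h : n ∈ received x s l i → t < recTime x s n) :
    age x s l i t = t - (genTime x n - arrivalAge x s l i n) := by
  have hset : {k ∈ received x s l i | recTime x s k ≤ t} = {k ∈ received x s l i | k < n} := by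
    ext k
    refine and_congr_right fun hk => ⟨fun h' => ?_, fun h' => ?_⟩
    · by_contra! hkn
      rcases hkn.eq_or_lt with rfl | hlt
      · exact absurd h' (not_le.2 (h hk))
      · have := (strictMono_genTime hx).monotone (Nat.succ_le_of_lt hlt)
        linarith [genTime_le_recTime (x := x) hs k]
    · exact (recTime_lt_of_lt hx hk h').le.trans h1
  rw [age, hset, (isGreatest_genTime_received hx n).csSup_eq]

/-- The age between the reception of update `n` and the next generation. -/
theorem age_eq_of_received (hx : ∀ n, 0 < x n) (hs : ∀ n, 0 ≤ s n) {n : ℕ} {t : ℝ}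
    (hn : n ∈ received x s l i) (h1 : recTime x s n ≤ t) (h2 : t < genTime x (n + 1)) :
    age x s l i t = t - genTime x n := by
  have hset : {k ∈ received x s l i | recTime x s k ≤ t} =
      {k ∈ received x s l i | k < n + 1} := by
    ext k
    refine and_congr_right fun hk => ⟨fun h' => ?_, fun h' => ?_⟩
    · by_contra! hkn
      have := (strictMono_genTime hx).monotone hkn
      linarith [genTime_le_recTime (x := x) hs k]
    · rcases (Nat.lt_succ_iff.1 h').eq_or_lt with rfl | hlt
      · exact h1
      · exact (recTime_lt_of_lt hx hk hlt).le.trans ((genTime_le_recTime hs n).trans h1)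
  rw [age, hset, (isGreatest_genTime_received hx (n + 1)).csSup_eq, arrivalAge, genTime_succ,
    success_mark, if_pos hn]
  ring

theorem age_eq_self_of_lt (hx : ∀ n, 0 < x n) (hs : ∀ n, 0 ≤ s n) {t : ℝ} (h : t < genTime x 0) :
    age x s l i t = t := by
  have hset : {k ∈ received x s l i | recTime x s k ≤ t} = ∅ := by
    ext k
    simp only [Set.mem_ofPred_eq, Set.mem_empty_iff_false, iff_false, not_and, not_le]
    intro _
    exact h.trans_le (((strictMono_genTime hx).monotone (Nat.zero_le k)).trans
      (genTime_le_recTime hs k))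
  rw [age, hset]
  simp

/-- The receptions strictly before that of update `n` are those with index below `n`, so since the
generation of update `n` the age has only grown, by the service time. -/
theorem ageBefore_recTime (hx : ∀ n, 0 < x n) (hs : ∀ n, 0 ≤ s n) {n : ℕ}
    (hn : n ∈ received x s l i) :
    ageBefore x s l i (recTime x s n) = arrivalAge x s l i n + s n := by
  have hset : {k ∈ received x s l i | recTime x s k < recTime x s n} =
      {k ∈ received x s l i | k < n} := by
    ext k
    refine and_congr_right fun hk => ⟨fun h' => ?_, fun h' => ?_⟩
    · by_contra! hkn
      rcases hkn.eq_or_lt with rfl | hlt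
      · exact lt_irrefl _ h'
      · linarith [recTime_lt_of_lt hx hn hlt, genTime_le_recTime (x := x) hs k]
    · exact (recTime_lt_of_lt hx hk h').trans_le (genTime_le_recTime hs n)
  rw [ageBefore, hset, (isGreatest_genTime_received hx n).csSup_eq, recTime]
  ring

theorem lintegral_Ico_ofReal_sub {a b c : ℝ} (hca : c ≤ a) (hab : a ≤ b) :
    ∫⁻ t in Set.Ico a b, ENNReal.ofReal (t - c) =
      ENNReal.ofReal (((b - c) ^ 2 - (a - c) ^ 2) / 2) := by
  have hint : IntervalIntegrable (fun t => t - c) volume a b :=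
    (continuous_id.sub continuous_const).intervalIntegrable a b
  rw [restrict_Ico_eq_restrict_Ioc, ← ofReal_integral_eq_lintegral_ofReal
    ((intervalIntegrable_iff_integrableOn_Ioc_of_le hab).1 hint)
    ((ae_restrict_iff' measurableSet_Ioc).2 (ae_of_all _ fun t ht => by
      simp only [Pi.zero_apply]; linarith [ht.1])),
    ← intervalIntegral.integral_of_le hab]
  congr 1
  rw [intervalIntegral.integral_comp_sub_right (fun t => t) c, integral_id]

/-- The age grows with slope one from `arrivalAge`. A reception lowers it by exactly `arrivalAge`
for the remaining time `x (n + 1) - s n`; the rectangle removed in this way is what distinguishes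
`hold` from the full interarrival time. -/
theorem lintegral_age_Ico_genTime (hx : ∀ n, 0 < x n) (hs : ∀ n, 0 ≤ s n) (n : ℕ) :
    ∫⁻ t in Set.Ico (genTime x n) (genTime x (n + 1)), ENNReal.ofReal (age x s l i t) =
      ENNReal.ofReal (x (n + 1) ^ 2 / 2 + arrivalAge x s l i n * hold i (mark x s l n)) := by
  have ha := arrivalAge_nonneg (s := s) (l := l) (i := i) hx n
  have hg := genTime_succ x n
  have hxn := hx (n + 1)
  rw [hold, success_mark]
  split_ifs with h
  · have h1 := genTime_le_recTime (x := x) hs n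
    have h2 : recTime x s n < genTime x (n + 1) := h.2
    rw [← Set.Ico_union_Ico_eq_Ico h1 h2.le, lintegral_union measurableSet_Ico
      (Set.Ico_disjoint_Ico_same),
      setLIntegral_congr_fun (s := Set.Ico (genTime x n) (recTime x s n)) (g := fun t =>
        ENNReal.ofReal (t - (genTime x n - arrivalAge x s l i n))) measurableSet_Ico
        fun t ht => congrArg ENNReal.ofReal
          (age_eq_of_not_received hx hs ht.1 (ht.2.trans h2) fun _ => ht.2),
      setLIntegral_congr_fun (s := Set.Ico (recTime x s n) (genTime x (n + 1)))
        (g := fun t => ENNReal.ofReal (t - genTime x n)) measurableSet_Ico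
        fun t ht => congrArg ENNReal.ofReal (age_eq_of_received hx hs h ht.1 ht.2),
      lintegral_Ico_ofReal_sub (by linarith) h1, lintegral_Ico_ofReal_sub h1 h2.le,
      ← ENNReal.ofReal_add]
    · congr 1
      simp only [mark, hg, recTime]
      ring
    · simp only [recTime]
      nlinarith [hs n]
    · rw [hg, recTime]
      have := (mem_received.1 h).2
      nlinarith [hs n]
  · rw [setLIntegral_congr_fun (g := fun t =>
        ENNReal.ofReal (t - (genTime x n - arrivalAge x s l i n))) measurableSet_Ico
        fun t ht => by rw [age_eq_of_not_received hx hs ht.1 ht.2 fun h' => absurd h' h],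
      lintegral_Ico_ofReal_sub (by linarith) (by linarith)]
    congr 1
    simp only [mark, hg]
    ring

theorem hold_mark_nonneg (hx : ∀ n, 0 < x n) (hs : ∀ n, 0 ≤ s n) (n : ℕ) :
    0 ≤ hold i (mark x s l n) := by
  have h1 := success_le_one i (mark x s l n)
  have h0 := success_nonneg i (mark x s l n)
  have := mul_nonneg (sub_nonneg.2 h1) (hx (n + 1)).le
  have := mul_nonneg h0 (hs n)
  simp only [hold, mark] at *
  linarith

/-- The area below the age up to the generation of update `N`. -/
theorem lintegral_age_genTime (hx : ∀ n, 0 < x n) (hs : ∀ n, 0 ≤ s n) (N : ℕ) :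
    ∫⁻ t in Set.Ioc 0 (genTime x N), ENNReal.ofReal (age x s l i t) =
      ENNReal.ofReal (x 0 ^ 2 / 2 + ∑ n ∈ Finset.range N,
        (x (n + 1) ^ 2 / 2 + arrivalAge x s l i n * hold i (mark x s l n))) := by
  rw [← restrict_Ico_eq_restrict_Ioc]
  induction N with
  | zero =>
    rw [setLIntegral_congr_fun (g := fun t => ENNReal.ofReal (t - 0)) measurableSet_Ico
        fun t ht => by simp only [age_eq_self_of_lt hx hs ht.2, sub_zero],
      lintegral_Ico_ofReal_sub le_rfl (genTime_pos hx 0).le]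
    congr 1
    rw [genTime_zero]
    simp
  | succ N ih =>
    have hstep := mul_nonneg (arrivalAge_nonneg (s := s) (l := l) (i := i) hx N)
      (hold_mark_nonneg (l := l) (i := i) hx hs N)
    rw [← Set.Ico_union_Ico_eq_Ico (genTime_pos hx N).le
      (strictMono_genTime hx (Nat.lt_succ_self N)).le,
      lintegral_union measurableSet_Ico (Set.Ico_disjoint_Ico_same), ih,
      lintegral_age_Ico_genTime hx hs, ← ENNReal.ofReal_add, Finset.sum_range_succ, add_assoc]
    · have := Finset.sum_nonneg fun n (_ : n ∈ Finset.range N) => add_nonneg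
        (div_nonneg (sq_nonneg (x (n + 1))) zero_le_two)
        (mul_nonneg (arrivalAge_nonneg (s := s) (l := l) (i := i) hx n)
          (hold_mark_nonneg (l := l) (i := i) hx hs n))
      positivity
    · positivity

/-! ### Time averages and peak averages from averages over updates -/

theorem tendsto_div_natCast_of_succ {f : ℕ → ℝ} {c : ℝ}
    (hf : Tendsto (fun n : ℕ => f n / n) atTop (𝓝 c)) :
    Tendsto (fun n : ℕ => f (n + 1) / n) atTop (𝓝 c) := by
  have h1 : Tendsto (fun n : ℕ => ((n + 1 : ℕ) : ℝ) / n) atTop (𝓝 1) := by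
    have h : Tendsto (fun n : ℕ => 1 + 1 / (n : ℝ)) atTop (𝓝 (1 + 0)) :=
      tendsto_const_nhds.add tendsto_one_div_atTop_nhds_zero_nat
    rw [add_zero] at h
    refine h.congr' ?_
    filter_upwards [eventually_gt_atTop 0] with n hn
    have : (n : ℝ) ≠ 0 := by positivity
    push_cast
    field_simp
  have h2 := ((tendsto_add_atTop_iff_nat 1).2 hf).mul h1
  rw [mul_one] at h2
  refine h2.congr fun n => ?_
  have : ((n + 1 : ℕ) : ℝ) ≠ 0 := by positivity
  exact div_mul_div_cancel₀ this

/-- The area is monotone in the horizon: between the generations of updates `N` and `N + 1` the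
quotient lies between area `N` over time `N + 1` and area `N + 1` over time `N`, and both bounds
tend to `v / m`. -/
theorem hasAvgAge_of_tendsto (hx : ∀ n, 0 < x n) (hs : ∀ n, 0 ≤ s n) {m v : ℝ} (hm : 0 < m)
    (hG : Tendsto (fun N : ℕ => genTime x N / N) atTop (𝓝 m))
    (hv : Tendsto (fun N : ℕ => (∑ n ∈ Finset.range N,
      (x (n + 1) ^ 2 / 2 + arrivalAge x s l i n * hold i (mark x s l n))) / (N : ℝ))
      atTop (𝓝 v)) :
    HasAvgAge x s l i (ENNReal.ofReal (v / m)) := by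
  set J : ℕ → ℝ := fun N => x 0 ^ 2 / 2 + ∑ n ∈ Finset.range N,
      (x (n + 1) ^ 2 / 2 + arrivalAge x s l i n * hold i (mark x s l n)) with hJ
  have hJv : Tendsto (fun N : ℕ => J N / N) atTop (𝓝 v) := by
    have h := (tendsto_const_div_atTop_nhds_zero_nat (𝕜 := ℝ) (x 0 ^ 2 / 2)).add hv
    rw [zero_add] at h
    refine h.congr fun N => ?_
    rw [← add_div]
  have hratio : ∀ {f g : ℕ → ℝ}, Tendsto (fun N : ℕ => f N / N) atTop (𝓝 v) →
      Tendsto (fun N : ℕ => g N / N) atTop (𝓝 m) →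
      Tendsto (fun N => f N / g N) atTop (𝓝 (v / m)) := by
    intro f g hf hg
    refine (hf.div hg hm.ne').congr' ?_
    filter_upwards [eventually_gt_atTop 0] with n hn
    exact div_div_div_cancel_right₀ (by positivity) _ _
  have hlow := hratio hJv (tendsto_div_natCast_of_succ hG)
  have hupp := hratio (tendsto_div_natCast_of_succ hJv) hG
  have hGtop : Tendsto (genTime x) atTop atTop := by
    have h := hG.pos_mul_atTop hm tendsto_natCast_atTop_atTop
    refine h.congr' ?_
    filter_upwards [eventually_gt_atTop 0] with n hn
    exact div_mul_cancel₀ _ (by positivity)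
  have hex : ∀ τ : ℝ, genTime x 0 ≤ τ → ∃ n, genTime x n ≤ τ ∧ τ < genTime x (n + 1) := by
    intro τ hτ
    by_contra! hcon
    have hall : ∀ n, genTime x n ≤ τ := fun n => by
      induction n with
      | zero => exact hτ
      | succ n ih => exact hcon n ih
    obtain ⟨n, hn⟩ := (hGtop.eventually_gt_atTop τ).exists
    exact absurd (hall n) (not_le.2 hn)
  -- Index 0 is a default for times before the first generation, making the choice of `N` total.
  have hex' : ∀ τ : ℝ, ∃ n, genTime x 0 ≤ τ → genTime x n ≤ τ ∧ τ < genTime x (n + 1) := by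
    intro τ
    by_cases hτ : genTime x 0 ≤ τ
    · obtain ⟨n, hn⟩ := hex τ hτ
      exact ⟨n, fun _ => hn⟩
    · exact ⟨0, fun h => absurd h hτ⟩
  choose N hN using hex'
  have hNtop : Tendsto N atTop atTop := by
    refine tendsto_atTop.2 fun b => ?_
    filter_upwards [eventually_ge_atTop (genTime x b), eventually_ge_atTop (genTime x 0)]
      with τ hb h0
    exact Nat.lt_succ_iff.1 ((strictMono_genTime hx).lt_iff_lt.1 (hb.trans_lt (hN τ h0).2))
  refine tendsto_of_tendsto_of_tendsto_of_le_of_le'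
    ((ENNReal.tendsto_ofReal hlow).comp hNtop) ((ENNReal.tendsto_ofReal hupp).comp hNtop) ?_ ?_
  · filter_upwards [eventually_ge_atTop (genTime x 0)] with τ h0
    have hpos : 0 < τ := (genTime_pos hx 0).trans_le h0
    obtain ⟨h1, h2⟩ := hN τ h0
    simp only [Function.comp_apply]
    rw [ENNReal.ofReal_div_of_pos (genTime_pos hx _), hJ]
    simp only
    rw [← lintegral_age_genTime hx hs]
    exact ENNReal.div_le_div (lintegral_mono_set (Set.Ioc_subset_Ioc_right h1))
      (ENNReal.ofReal_le_ofReal h2.le)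
  · filter_upwards [eventually_ge_atTop (genTime x 0)] with τ h0
    obtain ⟨h1, h2⟩ := hN τ h0
    simp only [Function.comp_apply]
    rw [ENNReal.ofReal_div_of_pos (genTime_pos hx _), hJ]
    simp only
    rw [← lintegral_age_genTime hx hs]
    exact ENNReal.div_le_div (lintegral_mono_set (Set.Ioc_subset_Ioc_right h2.le))
      (ENNReal.ofReal_le_ofReal h1)

theorem hasAvgAge_top_of_received_eq_empty (h : received x s l i = ∅) :
    HasAvgAge x s l i ∞ := by
  have hage : ∀ t, age x s l i t = t := fun t => by simp [age, h]
  have hlim : Tendsto (fun τ : ℝ => ENNReal.ofReal (τ / 2)) atTop (𝓝 ∞) :=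
    ENNReal.tendsto_ofReal_atTop.comp (tendsto_id.atTop_div_const zero_lt_two)
  refine hlim.congr' ?_
  filter_upwards [eventually_gt_atTop 0] with τ hτ
  have := lintegral_Ico_ofReal_sub (c := 0) le_rfl hτ.le
  simp only [hage]
  rw [restrict_Ico_eq_restrict_Ioc] at this
  simp only [sub_zero] at this
  rw [this, ← ENNReal.ofReal_div_of_pos hτ]
  congr 1
  field_simp
  ring

theorem hasAvgPeakAge_top_of_received_eq_empty (h : received x s l i = ∅) :
    HasAvgPeakAge x s l i ∞ := by
  have hp : ∀ j, peakAge x s l i j = ∞ := fun j => by simp [peakAge, h]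
  refine tendsto_const_nhds.congr' ?_
  filter_upwards [eventually_gt_atTop 0] with N hN
  simp only [hp, Finset.sum_const, Finset.card_range, nsmul_eq_mul]
  rw [ENNReal.mul_top (by positivity), ENNReal.top_div_of_ne_top (ENNReal.natCast_ne_top N)]

-- Peak ages are indexed by receptions and the law of large numbers by updates; this converts sums
-- of one kind into the other.
open Classical in
theorem sum_success_mul (f : ℕ → ℝ) (n : ℕ) :
    ∑ k ∈ Finset.range n, success i (mark x s l k) * f k =
      ∑ j ∈ Finset.range (Nat.count (· ∈ received x s l i) n),
        f (Nat.nth (· ∈ received x s l i) j) := by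
  induction n with
  | zero => simp
  | succ n ih =>
    rw [Finset.sum_range_succ, ih, Nat.count_succ, success_mark]
    split_ifs with h
    · rw [Finset.sum_range_succ, Nat.nth_count (p := (· ∈ received x s l i)) h, one_mul]
    · simp

/-- Finitely many receptions would have density zero. Infinitude makes `Nat.nth` a genuine
enumeration and excludes the value `∞` in `peakAge`. -/
theorem infinite_received {q : ℝ} (hq : 0 < q)
    (h : Tendsto (fun N : ℕ => (∑ n ∈ Finset.range N, success i (mark x s l n)) / N)
      atTop (𝓝 q)) : (received x s l i).Infinite := by
  classical
  intro hfin
  refine hq.ne (tendsto_nhds_unique (squeeze_zero (fun N => ?_) (fun N => ?_)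
    (tendsto_const_div_atTop_nhds_zero_nat (hfin.toFinset.card : ℝ))) h)
  · exact div_nonneg (Finset.sum_nonneg fun n _ => success_nonneg _ _) (Nat.cast_nonneg N)
  · gcongr
    simp only [success_mark, Finset.sum_boole]
    refine Nat.cast_le.2 (Finset.card_le_card fun n hn => ?_)
    exact hfin.mem_toFinset.2 (Finset.mem_filter.1 hn).2

theorem hasAvgPeakAge_of_tendsto (hx : ∀ n, 0 < x n) (hs : ∀ n, 0 ≤ s n) {q v : ℝ} (hq : 0 < q)
    (hr : Tendsto (fun N : ℕ => (∑ n ∈ Finset.range N, success i (mark x s l n)) / N)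
      atTop (𝓝 q))
    (hv : Tendsto (fun N : ℕ => (∑ n ∈ Finset.range N,
      success i (mark x s l n) * (arrivalAge x s l i n + s n)) / N) atTop (𝓝 v)) :
    HasAvgPeakAge x s l i (ENNReal.ofReal (v / q)) := by
  classical
  have hinf := infinite_received hq hr
  have hratio : Tendsto (fun N : ℕ => (∑ n ∈ Finset.range N,
      success i (mark x s l n) * (arrivalAge x s l i n + s n)) /
      ∑ n ∈ Finset.range N, success i (mark x s l n)) atTop (𝓝 (v / q)) := by
    refine (hv.div hr hq.ne').congr' ?_
    filter_upwards [eventually_gt_atTop 0] with n hn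
    exact div_div_div_cancel_right₀ (by positivity) _ _
  -- The ratio is read along the indices of the receptions: before reception number `N`, counted
  -- from 0, there are exactly `N` receptions, so the denominator becomes `N`.
  refine ((ENNReal.tendsto_ofReal hratio).comp
    (Nat.nth_strictMono (p := (· ∈ received x s l i)) hinf).tendsto_atTop).congr' ?_
  filter_upwards [eventually_gt_atTop 0] with N hN
  have hcount : Nat.count (· ∈ received x s l i) (Nat.nth (· ∈ received x s l i) N) = N :=
    Nat.count_nth_of_infinite (p := (· ∈ received x s l i)) hinf N
  have hone := sum_success_mul (x := x) (s := s) (l := l) (i := i) (fun _ => 1)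
    (Nat.nth (· ∈ received x s l i) N)
  simp only [hcount, mul_one, Finset.sum_const, Finset.card_range, nsmul_eq_mul] at hone
  simp only [Function.comp_apply]
  rw [hone, sum_success_mul (fun k => arrivalAge x s l i k + s k), hcount,
    ENNReal.ofReal_div_of_pos (by exact_mod_cast hN), ENNReal.ofReal_natCast,
    ENNReal.ofReal_sum_of_nonneg fun j _ => add_nonneg (arrivalAge_nonneg hx _) (hs _)]
  congr 1
  refine Finset.sum_congr rfl fun j _ => ?_
  rw [peakAge, if_pos (by rw [hinf.encard_eq]; exact ENat.natCast_lt_top j),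
    ageBefore_recTime hx hs (Nat.nth_mem_of_infinite (p := (· ∈ received x s l i)) hinf j)]

end SamplePath

/-! ### The exponential law and expectations over received updates -/

section Moments

variable {lam : ℝ}

theorem lintegral_expMeasure {f : ℝ → ℝ≥0∞} (hf : Measurable f) :
    ∫⁻ x, f x ∂expMeasure lam =
      ∫⁻ x in Set.Ioi 0, ENNReal.ofReal (lam * Real.exp (-(lam * x))) * f x := by
  have hdef : expMeasure lam = volume.withDensity (exponentialPDF lam) := rfl
  have hm : Measurable (exponentialPDF lam) :=
    (measurable_exponentialPDFReal lam).ennreal_ofReal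
  rw [hdef, lintegral_withDensity_eq_lintegral_mul _ hm hf, setLIntegral_congr Ioi_ae_eq_Ici,
    ← lintegral_indicator measurableSet_Ici]
  refine lintegral_congr fun x => ?_
  by_cases hx : 0 ≤ x
  · simp [hx, exponentialPDF_of_nonneg]
  · simp [hx, exponentialPDF_of_neg (not_le.1 hx)]

theorem ae_expMeasure_pos : ∀ᵐ x ∂expMeasure lam, 0 < x := by
  rw [ae_iff]
  simp only [not_lt]
  change expMeasure lam (Set.Iic 0) = 0
  rw [← lintegral_indicator_one measurableSet_Iic,
    lintegral_expMeasure (measurable_one.indicator measurableSet_Iic),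
    setLIntegral_congr_fun (g := fun _ => 0) measurableSet_Ioi fun x hx => ?_, lintegral_zero]
  simp [Set.mem_Ioi.1 hx]

/-- The exponential distribution is memoryless. -/
theorem map_sub_restrict_expMeasure {s : ℝ} (hs : 0 ≤ s) :
    ((expMeasure lam).restrict (Set.Ioi s)).map (fun x => x - s) =
      ENNReal.ofReal (Real.exp (-lam * s)) • expMeasure lam := by
  refine Measure.ext_of_lintegral _ fun f hf => ?_
  have hms : Measurable fun x : ℝ => x - s := measurable_id.sub_const s
  rw [lintegral_map hf hms, lintegral_smul_measure, ← lintegral_indicator measurableSet_Ioi,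
    lintegral_expMeasure (f := (Set.Ioi s).indicator fun x => f (x - s))
      ((hf.comp hms).indicator measurableSet_Ioi), lintegral_expMeasure hf,
    smul_eq_mul, ← lintegral_const_mul _ (by fun_prop), ← lintegral_indicator measurableSet_Ioi,
    ← lintegral_indicator measurableSet_Ioi, ← lintegral_add_right_eq_self _ s]
  -- After translation by `s` both integrals run over the positive half-line, and the density at `y
  -- + s` is `exp (-lam * s)` times the density at `y`.
  refine lintegral_congr fun y => ?_
  by_cases hy : 0 < y
  · have hys : 0 < y + s := by linarith
    simp only [Set.indicator, Set.mem_Ioi, hy, hys, lt_add_iff_pos_left, if_true,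
      add_sub_cancel_right, ← mul_assoc]
    rw [← ENNReal.ofReal_mul (Real.exp_pos _).le]
    congr 2
    rw [mul_left_comm, ← Real.exp_add]
    ring_nf
  · simp [Set.indicator, hy]

theorem setIntegral_expMeasure_comp_sub {s : ℝ} (hs : 0 ≤ s) {φ : ℝ → ℝ} (hφ : Measurable φ) :
    ∫ x in Set.Ioi s, φ (x - s) ∂expMeasure lam =
      Real.exp (-lam * s) * ∫ x, φ x ∂expMeasure lam := by
  have hms : Measurable fun x : ℝ => x - s := measurable_id.sub_const s
  rw [← integral_map (φ := fun x => x - s) hms.aemeasurable hφ.aestronglyMeasurable,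
    map_sub_restrict_expMeasure hs, integral_smul_measure,
    ENNReal.toReal_ofReal (Real.exp_pos _).le, smul_eq_mul]

theorem lintegral_pow_expMeasure (hlam : 0 < lam) (n : ℕ) :
    ∫⁻ x, ENNReal.ofReal (x ^ n) ∂expMeasure lam = ENNReal.ofReal (n.factorial / lam ^ n) := by
  have hval : ∫ x in Set.Ioi (0 : ℝ), lam * Real.exp (-(lam * x)) * x ^ n =
      n.factorial / lam ^ n := by
    have h := Real.integral_rpow_mul_exp_neg_mul_Ioi (a := n + 1) (by positivity) hlam
    rw [Real.Gamma_nat_eq_factorial, one_div, Real.inv_rpow hlam.le,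
      show ((n : ℝ) + 1) = ((n + 1 : ℕ) : ℝ) by push_cast; ring, Real.rpow_natCast] at h
    have h' : ∫ x in Set.Ioi (0 : ℝ), lam * Real.exp (-(lam * x)) * x ^ n =
        ∫ x in Set.Ioi (0 : ℝ), lam * (x ^ (((n + 1 : ℕ) : ℝ) - 1) * Real.exp (-(lam * x))) := by
      refine setIntegral_congr_fun measurableSet_Ioi fun x _ => ?_
      simp only [Nat.cast_add, Nat.cast_one, add_sub_cancel_right, Real.rpow_natCast]
      ring
    rw [h', integral_const_mul, h]
    field_simp
    ring
  -- The Bochner integral of a nonintegrable function is zero, so the nonzero value just computed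
  -- yields integrability.
  have hint : IntegrableOn (fun x => lam * Real.exp (-(lam * x)) * x ^ n) (Set.Ioi (0 : ℝ)) := by
    refine Integrable.of_integral_ne_zero ?_
    rw [hval]
    positivity
  rw [lintegral_expMeasure (by fun_prop), ← hval, ofReal_integral_eq_lintegral_ofReal hint
    ((ae_restrict_iff' measurableSet_Ioi).2 (ae_of_all _ fun x hx => by
      have : 0 < x := hx
      simp only [Pi.zero_apply]; positivity))]
  refine setLIntegral_congr_fun measurableSet_Ioi fun x hx => ?_
  have : 0 < x := hx
  rw [← ENNReal.ofReal_mul (by positivity)]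

theorem integrable_pow_expMeasure (hlam : 0 < lam) (n : ℕ) :
    Integrable (fun x => x ^ n) (expMeasure lam) := by
  refine ⟨by fun_prop, ?_⟩
  rw [hasFiniteIntegral_iff_ofReal (ae_expMeasure_pos.mono fun x hx => (pow_pos hx n).le),
    lintegral_pow_expMeasure hlam]
  exact ENNReal.ofReal_lt_top

theorem integral_pow_expMeasure (hlam : 0 < lam) (n : ℕ) :
    ∫ x, x ^ n ∂expMeasure lam = n.factorial / lam ^ n := by
  rw [integral_eq_lintegral_of_nonneg_ae (ae_expMeasure_pos.mono fun x hx => (pow_pos hx n).le)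
    (by fun_prop), lintegral_pow_expMeasure hlam, ENNReal.toReal_ofReal (by positivity)]

variable {M : ℕ} {p : Fin M → ℝ}

theorem isProbabilityMeasure_streamLaw (hp : p ∈ stdSimplex ℝ (Fin M)) :
    IsProbabilityMeasure (streamLaw p) := ⟨by
  simp only [streamLaw, Measure.coe_finsetSum, Finset.sum_apply, Measure.smul_apply,
    measure_univ, smul_eq_mul, mul_one]
  rw [← ENNReal.ofReal_sum_of_nonneg fun i _ => hp.1 i, hp.2, ENNReal.ofReal_one]⟩

theorem streamLaw_singleton (i : Fin M) : streamLaw p {i} = ENNReal.ofReal (p i) := by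
  simp only [streamLaw, Measure.coe_finsetSum, Finset.sum_apply, Measure.smul_apply,
    smul_eq_mul, Measure.dirac_apply' _ (measurableSet_singleton i)]
  rw [Finset.sum_eq_single i]
  · simp
  · intro j _ hj
    simp [hj]
  · simp

theorem measurable_success (i : Fin M) : Measurable (success i) := by
  unfold success
  refine Measurable.ite ?_ measurable_const measurable_const
  exact (measurableSet_eq_fun (measurable_snd.comp measurable_snd) measurable_const).inter
    (measurableSet_lt (measurable_fst.comp measurable_snd) measurable_fst)

theorem measurable_hold (i : Fin M) : Measurable (hold i) := by
  have := measurable_success i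
  unfold hold
  fun_prop

variable {ν : Measure ℝ} [IsProbabilityMeasure ν]

/-- Expectations over the received updates of stream `i`. -/
theorem integral_success_mul (hlam : 0 < lam) (hν : ∀ᵐ s ∂ν, 0 ≤ s)
    (hp : p ∈ stdSimplex ℝ (Fin M)) (i : Fin M) {φ ψ : ℝ → ℝ} (hφ : Measurable φ)
    (hint : Integrable (fun y : ℝ × ℝ × Fin M => success i y * (φ (y.1 - y.2.1) * ψ y.2.1))
      ((expMeasure lam).prod (ν.prod (streamLaw p)))) :
    ∫ y, success i y * (φ (y.1 - y.2.1) * ψ y.2.1)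
        ∂((expMeasure lam).prod (ν.prod (streamLaw p))) =
      p i * (∫ x, φ x ∂expMeasure lam) * ∫ s, ψ s * Real.exp (-lam * s) ∂ν := by
  have := isProbabilityMeasure_expMeasure hlam
  have := isProbabilityMeasure_streamLaw hp
  -- The interarrival time is integrated first, with service time and stream fixed: it exceeds the
  -- service time `s` with probability `exp (-lam * s)`, and the excess is then again exponential.
  rw [integral_prod_symm _ hint]
  have hae : ∀ᵐ z ∂ν.prod (streamLaw p), 0 ≤ z.1 :=
    Measure.quasiMeasurePreserving_fst.ae hν
  have hinner : ∀ᵐ z ∂ν.prod (streamLaw p),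
      ∫ x, success i (x, z) * (φ (x - z.1) * ψ z.1) ∂expMeasure lam =
        (∫ x, φ x ∂expMeasure lam) * ((ψ z.1 * Real.exp (-lam * z.1)) *
          ({i} : Set (Fin M)).indicator 1 z.2) := by
    filter_upwards [hae] with z hz
    by_cases hi : z.2 = i
    · have : ∀ x, success i (x, z) * (φ (x - z.1) * ψ z.1) =
          ψ z.1 * (Set.Ioi z.1).indicator (fun x => φ (x - z.1)) x := fun x => by
        by_cases hx : z.1 < x <;> simp [success, hi, hx, mul_comm]
      simp_rw [this]
      rw [integral_const_mul, integral_indicator measurableSet_Ioi,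
        setIntegral_expMeasure_comp_sub hz hφ]
      simp [hi]
      ring
    · simp [success, hi]
  rw [integral_congr_ae hinner, integral_const_mul,
    integral_prod_mul (fun s => ψ s * Real.exp (-lam * s)) (({i} : Set (Fin M)).indicator 1),
    integral_indicator_one (measurableSet_singleton i), Measure.real, streamLaw_singleton,
    ENNReal.toReal_ofReal (hp.1 i)]
  ring

end Moments

/-! ### Independence of marks from the past -/

section Input

set_option linter.unusedSectionVars false

variable {Ω : Type*} [mΩ : MeasurableSpace Ω] {μ : Measure Ω}

/-- This is the form in which the independence of the two components of one triple enters
`iIndepFun_uncurry'`. -/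
theorem iIndepFun_bool_of_indepFun [IsProbabilityMeasure μ] {β : Bool → Type*}
    [∀ b, MeasurableSpace (β b)] {f : ∀ b, Ω → β b} (h : IndepFun (f true) (f false) μ) :
    iIndepFun f μ := by
  rw [iIndepFun_iff_measure_inter_preimage_eq_mul]
  intro T sets hsets
  have hT : T = ∅ ∨ T = {true} ∨ T = {false} ∨ T = {true, false} := by
    clear hsets; revert T; decide
  rcases hT with rfl | rfl | rfl | rfl
  · simp
  · simp
  · simp
  · have := h.measure_inter_preimage_eq_mul (sets true) (sets false) (hsets true (by simp))
      (hsets false (by simp))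
    have hInter : (⋂ b ∈ ({true, false} : Finset Bool), f b ⁻¹' sets b) =
        f true ⁻¹' sets true ∩ f false ⁻¹' sets false := by
      ext ω; simp [and_comm]
    rw [hInter, this, Finset.prod_pair (by decide)]

variable {M : ℕ} {lam : ℝ} {ν : Measure ℝ} [IsProbabilityMeasure ν] {p : Fin M → ℝ}
  {X S : ℕ → Ω → ℝ} {L : ℕ → Ω → Fin M}

theorem hasLaw_interarrival (hlam : 0 < lam) (hp : p ∈ stdSimplex ℝ (Fin M))
    (h : IsInput μ lam ν p X S L) (n : ℕ) : HasLaw (X n) (expMeasure lam) μ := by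
  have := isProbabilityMeasure_expMeasure hlam
  have := isProbabilityMeasure_streamLaw hp
  exact measurePreserving_fst.hasLaw.comp (h.hasLaw n)

theorem hasLaw_service (hlam : 0 < lam) (hp : p ∈ stdSimplex ℝ (Fin M))
    (h : IsInput μ lam ν p X S L) (n : ℕ) :
    HasLaw (fun ω => (S n ω, L n ω)) (ν.prod (streamLaw p)) μ := by
  have := isProbabilityMeasure_expMeasure hlam
  have := isProbabilityMeasure_streamLaw hp
  exact measurePreserving_snd.hasLaw.comp (h.hasLaw n)

theorem indepFun_interarrival_service [IsProbabilityMeasure μ] (hlam : 0 < lam)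
    (hp : p ∈ stdSimplex ℝ (Fin M)) (h : IsInput μ lam ν p X S L) (n : ℕ) :
    IndepFun (X n) (fun ω => (S n ω, L n ω)) μ := by
  rw [indepFun_iff_map_prod_eq_prod_map_map (hasLaw_interarrival hlam hp h n).aemeasurable
    (hasLaw_service hlam hp h n).aemeasurable, (hasLaw_interarrival hlam hp h n).map_eq,
    (hasLaw_service hlam hp h n).map_eq]
  exact (h.hasLaw n).map_eq

/-- A mark takes its interarrival time from triple `n + 1` and the rest from triple `n`;
independence of the triples gives the same product law. -/
theorem hasLaw_mark [IsProbabilityMeasure μ] (hlam : 0 < lam)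
    (hp : p ∈ stdSimplex ℝ (Fin M)) (h : IsInput μ lam ν p X S L) (n : ℕ) :
    HasLaw (fun ω => mark (X · ω) (S · ω) (L · ω) n)
      ((expMeasure lam).prod (ν.prod (streamLaw p))) μ := by
  have hX := hasLaw_interarrival hlam hp h (n + 1)
  have hS := hasLaw_service hlam hp h n
  have hind : IndepFun (X (n + 1)) (fun ω => (S n ω, L n ω)) μ :=
    (h.indep.indepFun (Nat.succ_ne_self n)).comp measurable_fst measurable_snd
  refine ⟨hX.aemeasurable.prodMk hS.aemeasurable, ?_⟩
  have := hind.map_prod_eq_prod_map_map hX.aemeasurable hS.aemeasurable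
  rwa [hX.map_eq, hS.map_eq] at this

theorem integral_comp_mark [IsProbabilityMeasure μ] (hlam : 0 < lam)
    (hp : p ∈ stdSimplex ℝ (Fin M)) (h : IsInput μ lam ν p X S L) (n : ℕ)
    {f : ℝ × ℝ × Fin M → ℝ} (hf : Measurable f) :
    ∫ ω, f (mark (X · ω) (S · ω) (L · ω) n) ∂μ =
      ∫ y, f y ∂((expMeasure lam).prod (ν.prod (streamLaw p))) :=
  (hasLaw_mark hlam hp h n).integral_comp hf.aestronglyMeasurable

/-- The values of an interarrival time (`true`) and of a service time with a stream (`false`). -/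
abbrev ComponentType (M : ℕ) (b : Bool) : Type := cond b ℝ (ℝ × Fin M)

instance (M : ℕ) : ∀ b, MeasurableSpace (ComponentType M b)
  | true => inferInstanceAs (MeasurableSpace ℝ)
  | false => inferInstanceAs (MeasurableSpace (ℝ × Fin M))

/-- The two independent components of the triple of one update. -/
def component (X S : ℕ → Ω → ℝ) (L : ℕ → Ω → Fin M) (n : ℕ) : ∀ b, Ω → ComponentType M b
  | true => X n
  | false => fun ω => (S n ω, L n ω)

/-- Marks straddle consecutive triples, so independence is needed at the level of components,
indexed by `ℕ × Bool`. -/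
theorem iIndepFun_component [IsProbabilityMeasure μ] (hlam : 0 < lam)
    (hp : p ∈ stdSimplex ℝ (Fin M)) (h : IsInput μ lam ν p X S L)
    (hX : ∀ n, Measurable (X n)) (hS : ∀ n, Measurable (S n)) (hL : ∀ n, Measurable (L n)) :
    iIndepFun (fun (k : ℕ × Bool) ω => component X S L k.1 k.2 ω) μ := by
  refine iIndepFun_uncurry' (X := component X S L) ?_ ?_ ?_
  · rintro n (_ | _)
    · exact (hS n).prodMk (hL n)
    · exact hX n
  · let g : ℝ × ℝ × Fin M → ∀ b, ComponentType M b := fun z b =>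
      match b with
      | true => z.1
      | false => z.2
    have hg : Measurable g := measurable_pi_lambda _ fun b => by
      cases b
      · exact measurable_snd
      · exact measurable_fst
    refine (h.indep.comp (fun _ => g) fun _ => hg).congr fun n => ae_of_all _ fun ω => ?_
    funext b
    cases b <;> rfl
  · exact fun n => iIndepFun_bool_of_indepFun (indepFun_interarrival_service hlam hp h n)

/-- The components that determine the age at the generation time of update `n`. -/
def pastIndex (n : ℕ) : Set (ℕ × Bool) := {k | k.1 < n ∨ (k.1 = n ∧ k.2 = true)}

/-- The information available at the generation time of update `n`. -/
@[reducible]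
def past (X S : ℕ → Ω → ℝ) (L : ℕ → Ω → Fin M) (n : ℕ) : MeasurableSpace Ω :=
  ⨆ k ∈ pastIndex n, MeasurableSpace.comap (component X S L k.1 k.2) inferInstance

theorem past_mono : Monotone (past X S L) := fun m n hmn =>
  biSup_mono fun k hk => by
    rcases hk with hk | ⟨hk, hk'⟩
    · exact Or.inl (hk.trans_le hmn)
    · rcases hmn.eq_or_lt with rfl | hlt
      · exact Or.inr ⟨hk, hk'⟩
      · exact Or.inl (hk ▸ hlt)

theorem measurable_component_of_mem (T : Set (ℕ × Bool)) {n : ℕ} {b : Bool} (hk : (n, b) ∈ T) :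
    Measurable[⨆ k ∈ T, MeasurableSpace.comap (component X S L k.1 k.2) inferInstance]
      (component X S L n b) :=
  Measurable.of_comap_le (le_biSup
    (fun k : ℕ × Bool => MeasurableSpace.comap (component X S L k.1 k.2) inferInstance) hk)

theorem measurable_component (hX : ∀ n, Measurable (X n)) (hS : ∀ n, Measurable (S n))
    (hL : ∀ n, Measurable (L n)) (n : ℕ) (b : Bool) : Measurable (component X S L n b) := by
  cases b
  · exact (hS n).prodMk (hL n)
  · exact hX n

theorem past_le (hX : ∀ n, Measurable (X n)) (hS : ∀ n, Measurable (S n))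
    (hL : ∀ n, Measurable (L n)) (n : ℕ) : past X S L n ≤ mΩ :=
  iSup₂_le fun k _ => (measurable_component hX hS hL k.1 k.2).comap_le

theorem measurable_past_interarrival (n : ℕ) : Measurable[past X S L n] (X n) :=
  measurable_component_of_mem (pastIndex n) (n := n) (b := true) (Or.inr ⟨rfl, rfl⟩)

theorem measurable_past_mark (n : ℕ) :
    Measurable[past X S L (n + 1)] fun ω => mark (X · ω) (S · ω) (L · ω) n :=
  Measurable.prodMk (measurable_past_interarrival (n + 1))
    (measurable_component_of_mem (pastIndex (n + 1)) (n := n) (b := false)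
      (Or.inl (Nat.lt_succ_self n)))

/-- The past uses interarrival times up to index `n` and services up to `n - 1`; the mark uses
interarrival time `n + 1` and service `n`. These are disjoint sets of independent components. -/
theorem indep_past_mark [IsProbabilityMeasure μ] (hlam : 0 < lam)
    (hp : p ∈ stdSimplex ℝ (Fin M)) (h : IsInput μ lam ν p X S L)
    (hX : ∀ n, Measurable (X n)) (hS : ∀ n, Measurable (S n)) (hL : ∀ n, Measurable (L n))
    (n : ℕ) :
    Indep (past X S L n)
      (MeasurableSpace.comap (fun ω => mark (X · ω) (S · ω) (L · ω) n) inferInstance) μ := by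
  let T : Set (ℕ × Bool) := {(n + 1, true), (n, false)}
  have hdisj : Disjoint (pastIndex n) T := by
    rw [Set.disjoint_left]
    rintro ⟨k, b⟩ hk hk'
    rcases hk' with hk' | hk'
    · obtain ⟨rfl, rfl⟩ := Prod.mk.inj hk'
      rcases hk with hk | ⟨hk, -⟩ <;> simp at hk
    · obtain ⟨rfl, rfl⟩ := Prod.mk.inj hk'
      rcases hk with hk | ⟨-, hk⟩ <;> simp at hk
  have hind := indep_iSup_of_disjoint
    (m := fun k : ℕ × Bool => MeasurableSpace.comap (component X S L k.1 k.2) inferInstance)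
    (fun k => (measurable_component hX hS hL k.1 k.2).comap_le)
    ((iIndepFun_iff_iIndep _ _ _).1 (iIndepFun_component hlam hp h hX hS hL)) hdisj
  refine indep_of_indep_of_le_right hind (Measurable.comap_le ?_)
  exact Measurable.prodMk
    (measurable_component_of_mem T (n := n + 1) (b := true) (Or.inl rfl))
    (measurable_component_of_mem T (n := n) (b := false) (Or.inr rfl))

theorem measurable_arrivalAge (i : Fin M) (n : ℕ) :
    Measurable[past X S L n] fun ω => arrivalAge (X · ω) (S · ω) (L · ω) i n := by
  induction n with
  | zero => exact measurable_past_interarrival 0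
  | succ n ih =>
    have h1 := ih.mono (past_mono (Nat.le_succ n)) le_rfl
    have h2 := (measurable_success i).comp (measurable_past_mark (X := X) (S := S) (L := L) n)
    exact ((measurable_const.sub h2).mul h1).add (measurable_past_interarrival (n + 1))

theorem indepFun_past_mark [IsProbabilityMeasure μ] (hlam : 0 < lam)
    (hp : p ∈ stdSimplex ℝ (Fin M)) (h : IsInput μ lam ν p X S L)
    (hX : ∀ n, Measurable (X n)) (hS : ∀ n, Measurable (S n)) (hL : ∀ n, Measurable (L n))
    {n : ℕ} {b : Ω → ℝ} (hb : Measurable[past X S L n] b) {f : ℝ × ℝ × Fin M → ℝ}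
    (hf : Measurable f) : IndepFun b (fun ω => f (mark (X · ω) (S · ω) (L · ω) n)) μ := by
  rw [IndepFun_iff_Indep]
  refine indep_of_indep_of_le_left (indep_of_indep_of_le_right
    (indep_past_mark hlam hp h hX hS hL n) ?_) hb.comap_le
  exact Measurable.comap_le (hf.comp (comap_measurable _))

/-- A strong law of large numbers for the marks with weights determined by the past. -/
theorem ae_tendsto_average_mul_mark [IsProbabilityMeasure μ] (hlam : 0 < lam)
    (hp : p ∈ stdSimplex ℝ (Fin M)) (h : IsInput μ lam ν p X S L)
    (hX : ∀ n, Measurable (X n)) (hS : ∀ n, Measurable (S n)) (hL : ∀ n, Measurable (L n))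
    {b : ℕ → Ω → ℝ} (hb : ∀ n, Measurable[past X S L n] (b n)) (hb2 : ∀ n, MemLp (b n) 2 μ)
    {B : ℝ} (hB : ∀ n, ∫ ω, b n ω ^ 2 ∂μ ≤ B) {f : ℝ × ℝ × Fin M → ℝ} (hf : Measurable f)
    (hf2 : MemLp f 2 ((expMeasure lam).prod (ν.prod (streamLaw p)))) {c : ℝ}
    (hc : ∫ y, f y ∂((expMeasure lam).prod (ν.prod (streamLaw p))) = c) :
    ∀ᵐ ω ∂μ, Tendsto (fun N : ℕ => (∑ n ∈ Finset.range N,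
      b n ω * (f (mark (X · ω) (S · ω) (L · ω) n) - c)) / (N : ℝ)) atTop (𝓝 0) := by
  have := isProbabilityMeasure_expMeasure hlam
  have := isProbabilityMeasure_streamLaw hp
  set π := (expMeasure lam).prod (ν.prod (streamLaw p))
  let Y : ℕ → Ω → ℝ × ℝ × Fin M := fun n ω => mark (X · ω) (S · ω) (L · ω) n
  let g : ℝ × ℝ × Fin M → ℝ := fun y => f y - c
  have hg : Measurable g := hf.sub_const c
  have hg2 : MemLp g 2 π := hf2.sub (memLp_const c)
  have hg0 : ∫ y, g y ∂π = 0 := by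
    simp only [g]
    rw [integral_sub (hf2.integrable one_le_two) (integrable_const c), hc]
    simp
  have hY : ∀ n, MeasurePreserving (Y n) μ π := fun n =>
    (hasLaw_mark hlam hp h n).measurePreserving
      ((measurable_past_mark n).mono (past_le hX hS hL (n + 1)) le_rfl)
  have hgY : ∀ n, MemLp (fun ω => g (Y n ω)) 2 μ := fun n => hg2.comp_measurePreserving (hY n)
  have hgY0 : ∀ n, ∫ ω, g (Y n ω) ∂μ = 0 := fun n => by
    rw [integral_comp_mark hlam hp h n hg, hg0]
  have hbm : ∀ n, Measurable (b n) := fun n => (hb n).mono (past_le hX hS hL n) le_rfl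
  have hgm : ∀ n, Measurable fun ω => g (Y n ω) := fun n => hg.comp (hY n).measurable
  -- A product of square-integrable functions need not be square integrable; independence makes it
  -- so and factors its second moment.
  have hind2 : ∀ n, IndepFun (fun ω => b n ω ^ 2) (fun ω => g (Y n ω) ^ 2) μ := fun n =>
    indepFun_past_mark hlam hp h hX hS hL ((hb n).pow_const 2) (hg.pow_const 2)
  have hsq : ∀ n, (fun ω => (b n ω * g (Y n ω)) ^ 2) =
      fun ω => b n ω ^ 2 * g (Y n ω) ^ 2 := fun n => funext fun ω => mul_pow _ _ _
  have hZ : ∀ n, MemLp (fun ω => b n ω * g (Y n ω)) 2 μ := fun n => by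
    refine (memLp_two_iff_integrable_sq ((hbm n).mul (hgm n)).aestronglyMeasurable).2 ?_
    change Integrable (fun ω => (b n ω * g (Y n ω)) ^ 2) μ
    rw [hsq]
    exact (hind2 n).integrable_mul (hb2 n).integrable_sq (hgY n).integrable_sq
  refine ae_tendsto_average_zero_of_orthogonal (C := B * ∫ y, g y ^ 2 ∂π) hZ ?_ ?_
  · intro m n hmn
    -- Orthogonality: for `m < n` every factor except the centred mark `n` is determined by the past
    -- of `n`, and that mark is independent of the past with mean zero.
    have hmeas : Measurable[past X S L n] fun ω => b m ω * g (Y m ω) * b n ω :=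
      ((((hb m).mono (past_mono hmn.le) le_rfl)).mul
        (hg.comp ((measurable_past_mark m).mono (past_mono (Nat.succ_le_of_lt hmn)) le_rfl))).mul
        (hb n)
    have hind := indepFun_past_mark hlam hp h hX hS hL hmeas hg
    have e : (fun ω => b m ω * g (Y m ω) * (b n ω * g (Y n ω))) =
        fun ω => b m ω * g (Y m ω) * b n ω * g (Y n ω) := funext fun ω => by ring
    rw [e, hind.integral_fun_mul_eq_mul_integral
      (hmeas.mono (past_le hX hS hL n) le_rfl).aestronglyMeasurable
      (hgm n).aestronglyMeasurable]
    exact mul_eq_zero_of_right _ (hgY0 n)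
  · intro n
    rw [hsq, (hind2 n).integral_fun_mul_eq_mul_integral
      ((hbm n).pow_const 2).aestronglyMeasurable ((hgm n).pow_const 2).aestronglyMeasurable,
      integral_comp_mark hlam hp h n (hg.pow_const 2)]
    exact mul_le_mul_of_nonneg_right (hB n) (integral_nonneg fun ω => sq_nonneg _)

/-- The strong law of large numbers for the marks. -/
theorem ae_tendsto_average_mark [IsProbabilityMeasure μ] (hlam : 0 < lam)
    (hp : p ∈ stdSimplex ℝ (Fin M)) (h : IsInput μ lam ν p X S L)
    (hX : ∀ n, Measurable (X n)) (hS : ∀ n, Measurable (S n)) (hL : ∀ n, Measurable (L n))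
    {f : ℝ × ℝ × Fin M → ℝ} (hf : Measurable f)
    (hf2 : MemLp f 2 ((expMeasure lam).prod (ν.prod (streamLaw p)))) {c : ℝ}
    (hc : ∫ y, f y ∂((expMeasure lam).prod (ν.prod (streamLaw p))) = c) :
    ∀ᵐ ω ∂μ, Tendsto (fun N : ℕ => (∑ n ∈ Finset.range N,
      f (mark (X · ω) (S · ω) (L · ω) n)) / (N : ℝ)) atTop (𝓝 c) := by
  have key := ae_tendsto_average_mul_mark hlam hp h hX hS hL (b := fun _ _ => 1)
    (fun _ => measurable_const) (fun _ => memLp_const 1) (B := 1) (by simp) hf hf2 hc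
  filter_upwards [key] with ω hω
  have h2 := hω.add_const c
  rw [zero_add] at h2
  refine h2.congr' ?_
  filter_upwards [eventually_gt_atTop 0] with N hN
  have hN' : (N : ℝ) ≠ 0 := by positivity
  simp only [one_mul, Finset.sum_sub_distrib, Finset.sum_const, Finset.card_range, nsmul_eq_mul]
  field_simp
  ring

end Input

/-! ### Moments of the marks and almost sure limits -/

section Limits

set_option linter.unusedSectionVars false

variable {M : ℕ} {lam : ℝ} {ν : Measure ℝ} [IsProbabilityMeasure ν] {p : Fin M → ℝ}

theorem integrable_exp_neg_mul (hlam : 0 < lam) (hν : ∀ᵐ s ∂ν, 0 ≤ s) :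
    Integrable (fun s => Real.exp (-lam * s)) ν := by
  refine Integrable.of_bound (by fun_prop) 1 ?_
  filter_upwards [hν] with s hs
  rw [Real.norm_eq_abs, Real.abs_exp, Real.exp_le_one_iff]
  nlinarith

theorem integral_exp_neg_mul_pos (hlam : 0 < lam) (hν : ∀ᵐ s ∂ν, 0 ≤ s) :
    0 < ∫ s, Real.exp (-lam * s) ∂ν :=
  integral_exp_pos (integrable_exp_neg_mul hlam hν)

theorem integral_exp_neg_mul_le_one (hlam : 0 < lam) (hν : ∀ᵐ s ∂ν, 0 ≤ s) :
    ∫ s, Real.exp (-lam * s) ∂ν ≤ 1 := by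
  have h := integral_mono_ae (integrable_exp_neg_mul hlam hν) (integrable_const (1 : ℝ)) ?_
  · simpa using h
  · filter_upwards [hν] with s hs
    rw [Real.exp_le_one_iff]
    nlinarith

theorem ae_prod_nonneg (hlam : 0 < lam) (hν : ∀ᵐ s ∂ν, 0 ≤ s) (hp : p ∈ stdSimplex ℝ (Fin M)) :
    ∀ᵐ y ∂(expMeasure lam).prod (ν.prod (streamLaw p)), 0 < y.1 ∧ 0 ≤ y.2.1 := by
  have := isProbabilityMeasure_expMeasure hlam
  have := isProbabilityMeasure_streamLaw hp
  have h1 : ∀ᵐ y ∂(expMeasure lam).prod (ν.prod (streamLaw p)), 0 < y.1 :=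
    Measure.quasiMeasurePreserving_fst.ae ae_expMeasure_pos
  have h2 : ∀ᵐ y ∂(expMeasure lam).prod (ν.prod (streamLaw p)), 0 ≤ y.2.1 :=
    (Measure.quasiMeasurePreserving_fst.comp Measure.quasiMeasurePreserving_snd).ae hν
  exact h1.and h2

theorem integrable_fst_pow (hlam : 0 < lam) (hp : p ∈ stdSimplex ℝ (Fin M)) (n : ℕ) :
    Integrable (fun y : ℝ × ℝ × Fin M => y.1 ^ n)
      ((expMeasure lam).prod (ν.prod (streamLaw p))) := by
  have := isProbabilityMeasure_expMeasure hlam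
  have := isProbabilityMeasure_streamLaw hp
  exact measurePreserving_fst.integrable_comp_of_integrable (integrable_pow_expMeasure hlam n)

theorem integral_fst_pow (hlam : 0 < lam) (hp : p ∈ stdSimplex ℝ (Fin M)) (n : ℕ) :
    ∫ y, y.1 ^ n ∂((expMeasure lam).prod (ν.prod (streamLaw p))) = n.factorial / lam ^ n := by
  have := isProbabilityMeasure_expMeasure hlam
  have := isProbabilityMeasure_streamLaw hp
  rw [integral_fun_fst (fun x : ℝ => x ^ n), integral_pow_expMeasure hlam]
  simp

theorem memLp_fst_pow (hlam : 0 < lam) (hp : p ∈ stdSimplex ℝ (Fin M)) (n : ℕ) :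
    MemLp (fun y : ℝ × ℝ × Fin M => y.1 ^ n) 2
      ((expMeasure lam).prod (ν.prod (streamLaw p))) := by
  rw [memLp_two_iff_integrable_sq (by fun_prop)]
  simp_rw [← pow_mul]
  exact integrable_fst_pow hlam hp _

theorem memLp_success (hlam : 0 < lam) (hp : p ∈ stdSimplex ℝ (Fin M)) (i : Fin M) :
    MemLp (success i) 2 ((expMeasure lam).prod (ν.prod (streamLaw p))) := by
  have := isProbabilityMeasure_expMeasure hlam
  have := isProbabilityMeasure_streamLaw hp
  refine MemLp.of_bound (measurable_success i).aestronglyMeasurable 1 (ae_of_all _ fun y => ?_)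
  rw [Real.norm_eq_abs, abs_of_nonneg (success_nonneg i y)]
  exact success_le_one i y

/-- The service time may lack moments under `ν`. On success it is below the interarrival time, whose
moments are all finite, so domination by `y.1` suffices. -/
theorem memLp_of_abs_le_fst (hlam : 0 < lam) (hν : ∀ᵐ s ∂ν, 0 ≤ s)
    (hp : p ∈ stdSimplex ℝ (Fin M)) {f : ℝ × ℝ × Fin M → ℝ} (hf : Measurable f)
    (h : ∀ y : ℝ × ℝ × Fin M, 0 < y.1 → 0 ≤ y.2.1 → |f y| ≤ y.1) :
    MemLp f 2 ((expMeasure lam).prod (ν.prod (streamLaw p))) := by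
  refine (memLp_fst_pow hlam hp 1).mono hf.aestronglyMeasurable ?_
  filter_upwards [ae_prod_nonneg hlam hν hp] with y hy
  simp only [Real.norm_eq_abs, pow_one]
  exact (h y hy.1 hy.2).trans (le_abs_self _)

theorem memLp_success_mul_service (hlam : 0 < lam) (hν : ∀ᵐ s ∂ν, 0 ≤ s)
    (hp : p ∈ stdSimplex ℝ (Fin M)) (i : Fin M) :
    MemLp (fun y => success i y * y.2.1) 2 ((expMeasure lam).prod (ν.prod (streamLaw p))) := by
  refine memLp_of_abs_le_fst hlam hν hp
    ((measurable_success i).mul (measurable_fst.comp measurable_snd)) fun y h1 h2 => ?_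
  unfold success
  split_ifs with h
  · rw [one_mul, abs_of_nonneg h2]; exact h.2.le
  · simpa using h1.le

theorem memLp_success_mul_sub (hlam : 0 < lam) (hν : ∀ᵐ s ∂ν, 0 ≤ s)
    (hp : p ∈ stdSimplex ℝ (Fin M)) (i : Fin M) :
    MemLp (fun y => success i y * (y.1 - y.2.1)) 2
      ((expMeasure lam).prod (ν.prod (streamLaw p))) := by
  refine memLp_of_abs_le_fst hlam hν hp ((measurable_success i).mul
    (measurable_fst.sub (measurable_fst.comp measurable_snd))) fun y h1 h2 => ?_
  unfold success
  split_ifs with h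
  · rw [one_mul, abs_of_nonneg (by linarith [h.2])]; linarith
  · simpa using h1.le

theorem memLp_hold (hlam : 0 < lam) (hν : ∀ᵐ s ∂ν, 0 ≤ s)
    (hp : p ∈ stdSimplex ℝ (Fin M)) (i : Fin M) :
    MemLp (hold i) 2 ((expMeasure lam).prod (ν.prod (streamLaw p))) := by
  have h := (memLp_fst_pow (ν := ν) hlam hp 1).sub (memLp_success_mul_sub hlam hν hp i)
  simp only [pow_one] at h
  exact h

/-- The probability that an update is a received update of stream `i`. -/
theorem integral_success (hlam : 0 < lam) (hν : ∀ᵐ s ∂ν, 0 ≤ s)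
    (hp : p ∈ stdSimplex ℝ (Fin M)) (i : Fin M) :
    ∫ y, success i y ∂((expMeasure lam).prod (ν.prod (streamLaw p))) =
      p i * ∫ s, Real.exp (-lam * s) ∂ν := by
  have := isProbabilityMeasure_expMeasure hlam
  have := isProbabilityMeasure_streamLaw hp
  have h := integral_success_mul hlam hν hp i (φ := fun _ => 1) (ψ := fun _ => 1)
    measurable_const (by simpa using (memLp_success hlam hp i).integrable one_le_two)
  simpa using h

theorem integral_success_mul_service (hlam : 0 < lam) (hν : ∀ᵐ s ∂ν, 0 ≤ s)
    (hp : p ∈ stdSimplex ℝ (Fin M)) (i : Fin M) :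
    ∫ y, success i y * y.2.1 ∂((expMeasure lam).prod (ν.prod (streamLaw p))) =
      p i * ∫ s, s * Real.exp (-lam * s) ∂ν := by
  have := isProbabilityMeasure_expMeasure hlam
  have := isProbabilityMeasure_streamLaw hp
  have h := integral_success_mul hlam hν hp i (φ := fun _ => 1) (ψ := fun s => s)
    measurable_const
    (by simpa using (memLp_success_mul_service hlam hν hp i).integrable one_le_two)
  simpa using h

/-- By memorylessness the time left after a success is exponential, so successes reduce the mean `1
/ lam` by their probability times `1 / lam`. -/
theorem integral_hold (hlam : 0 < lam) (hν : ∀ᵐ s ∂ν, 0 ≤ s)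
    (hp : p ∈ stdSimplex ℝ (Fin M)) (i : Fin M) :
    ∫ y, hold i y ∂((expMeasure lam).prod (ν.prod (streamLaw p))) =
      (1 - p i * ∫ s, Real.exp (-lam * s) ∂ν) / lam := by
  have := isProbabilityMeasure_expMeasure hlam
  have := isProbabilityMeasure_streamLaw hp
  have hint := (memLp_success_mul_sub hlam hν hp i).integrable one_le_two
  have h := integral_success_mul hlam hν hp i (φ := fun x => x) (ψ := fun _ => 1)
    measurable_id (by simpa using hint)
  have hmean := integral_pow_expMeasure hlam 1
  simp only [pow_one, Nat.factorial_one, Nat.cast_one] at hmean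
  have hfst := integral_fst_pow (ν := ν) hlam hp 1
  simp only [pow_one, Nat.factorial_one, Nat.cast_one] at hfst
  have hfi : Integrable (fun y : ℝ × ℝ × Fin M => y.1)
      ((expMeasure lam).prod (ν.prod (streamLaw p))) := by
    simpa using integrable_fst_pow (ν := ν) hlam hp 1
  simp only [mul_one, one_mul, hmean] at h
  unfold hold
  rw [integral_sub hfi hint, h, hfst]
  ring

variable {Ω : Type*} [mΩ : MeasurableSpace Ω] {μ : Measure Ω} [IsProbabilityMeasure μ]
  {X S : ℕ → Ω → ℝ} {L : ℕ → Ω → Fin M}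

/-- The ages at the generation times have bounded second moments. -/
theorem exists_bound_arrivalAge (hlam : 0 < lam) (hν : ∀ᵐ s ∂ν, 0 ≤ s)
    (hp : p ∈ stdSimplex ℝ (Fin M)) (h : IsInput μ lam ν p X S L)
    (hX : ∀ n, Measurable (X n)) (hS : ∀ n, Measurable (S n)) (hL : ∀ n, Measurable (L n))
    {i : Fin M} (hi : 0 < p i) :
    ∃ B : ℝ, ∀ n, MemLp (fun ω => arrivalAge (X · ω) (S · ω) (L · ω) i n) 2 μ ∧
      ∫ ω, arrivalAge (X · ω) (S · ω) (L · ω) i n ^ 2 ∂μ ≤ B := by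
  have := isProbabilityMeasure_expMeasure hlam
  have := isProbabilityMeasure_streamLaw hp
  set q := p i * ∫ s, Real.exp (-lam * s) ∂ν with hq
  have hq0 : 0 < q := mul_pos hi (integral_exp_neg_mul_pos hlam hν)
  have hpi : p i ≤ 1 := by
    rw [← hp.2]; exact Finset.single_le_sum (fun j _ => hp.1 j) (Finset.mem_univ i)
  have hq1 : q ≤ 1 := mul_le_one₀ hpi (integral_exp_neg_mul_pos hlam hν).le
    (integral_exp_neg_mul_le_one hlam hν)
  have hXsq : ∀ n, Integrable (fun ω => X n ω ^ 2) μ := fun n =>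
    ((hasLaw_interarrival hlam hp h n).measurePreserving (hX n)).integrable_comp_of_integrable
      (integrable_pow_expMeasure hlam 2)
  have hXint : ∀ n, ∫ ω, X n ω ^ 2 ∂μ = 2 / lam ^ 2 := fun n => by
    have e := (hasLaw_interarrival hlam hp h n).integral_comp (f := fun x : ℝ => x ^ 2)
      (by fun_prop)
    rw [integral_pow_expMeasure hlam] at e
    simpa using e
  -- From `(u + v) ^ 2 ≤ (1 + q) * u ^ 2 + (1 + 1 / q) * v ^ 2` and independence, each second moment
  -- is at most `1 - q ^ 2` times the previous one plus `K`; the fixed point of this recursion is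
  -- the bound `K / q ^ 2`.
  set K := (1 + 1 / q) * (2 / lam ^ 2) with hK
  have hAm : ∀ n, Measurable fun ω => arrivalAge (X · ω) (S · ω) (L · ω) i n := fun n =>
    (measurable_arrivalAge i n).mono (past_le hX hS hL n) le_rfl
  refine ⟨K / q ^ 2, fun n => ?_⟩
  induction n with
  | zero =>
    refine ⟨(memLp_two_iff_integrable_sq (hX 0).aestronglyMeasurable).2 (hXsq 0), ?_⟩
    simp only [arrivalAge]
    rw [hXint, le_div_iff₀ (by positivity), hK]
    have h1 : 2 / lam ^ 2 * q ^ 2 ≤ 2 / lam ^ 2 * 1 :=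
      mul_le_mul_of_nonneg_left (pow_le_one₀ hq0.le hq1) (by positivity)
    have h2 : 0 ≤ 1 / q * (2 / lam ^ 2) := by positivity
    linarith
  | succ n ih =>
    obtain ⟨ihm, ihb⟩ := ih
    set A : Ω → ℝ := fun ω => arrivalAge (X · ω) (S · ω) (L · ω) i n with hA
    let R : Ω → ℝ := fun ω => 1 - success i (mark (X · ω) (S · ω) (L · ω) n)
    have hRm : Measurable fun y : ℝ × ℝ × Fin M => 1 - success i y :=
      measurable_const.sub (measurable_success i)
    have hind : IndepFun (fun ω => A ω ^ 2) R μ :=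
      indepFun_past_mark hlam hp h hX hS hL ((measurable_arrivalAge i n).pow_const 2) hRm
    have hRint : ∫ ω, R ω ∂μ = 1 - q := by
      rw [integral_comp_mark hlam hp h n hRm, integral_sub (integrable_const _)
        ((memLp_success hlam hp i).integrable one_le_two), integral_success hlam hν hp, hq]
      simp
    have hRmeas : Measurable R := hRm.comp ((measurable_past_mark n).mono
      (past_le hX hS hL (n + 1)) le_rfl)
    have hR0 : ∀ ω, 0 ≤ R ω := fun ω => sub_nonneg.2 (success_le_one _ _)
    have hR1 : ∀ ω, R ω ≤ 1 := fun ω => sub_le_self _ (success_nonneg _ _)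
    have hRR : ∀ ω, R ω ^ 2 = R ω := fun ω => by
      have := success_sq i (mark (X · ω) (S · ω) (L · ω) n)
      simp only [R]
      linear_combination this
    have hAR : Integrable (fun ω => A ω ^ 2 * R ω) μ := by
      refine ihm.integrable_sq.mono
        (((hAm n).pow_const 2).mul hRmeas).aestronglyMeasurable (ae_of_all _ fun ω => ?_)
      rw [Real.norm_eq_abs, Real.norm_eq_abs, abs_of_nonneg (mul_nonneg (sq_nonneg _) (hR0 ω)),
        abs_of_nonneg (sq_nonneg _)]
      exact mul_le_of_le_one_right (sq_nonneg _) (hR1 ω)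
    have hdom : Integrable (fun ω => (1 + q) * (A ω ^ 2 * R ω) + (1 + 1 / q) * X (n + 1) ω ^ 2)
        μ := (hAR.const_mul _).add ((hXsq (n + 1)).const_mul _)
    have hle : ∀ ω, arrivalAge (X · ω) (S · ω) (L · ω) i (n + 1) ^ 2 ≤
        (1 + q) * (A ω ^ 2 * R ω) + (1 + 1 / q) * X (n + 1) ω ^ 2 := fun ω => by
      have e : arrivalAge (X · ω) (S · ω) (L · ω) i (n + 1) = R ω * A ω + X (n + 1) ω := rfl
      have h1 : 0 ≤ (q * (R ω * A ω) - X (n + 1) ω) ^ 2 / q := by positivity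
      have h2 : (1 + q) * (A ω ^ 2 * R ω) + (1 + 1 / q) * X (n + 1) ω ^ 2 -
          (R ω * A ω + X (n + 1) ω) ^ 2 = (q * (R ω * A ω) - X (n + 1) ω) ^ 2 / q := by
        rw [show A ω ^ 2 * R ω = A ω ^ 2 * R ω ^ 2 by rw [hRR]]
        field_simp
        ring
      rw [e]
      linarith
    have hsq : Integrable (fun ω => arrivalAge (X · ω) (S · ω) (L · ω) i (n + 1) ^ 2) μ := by
      refine hdom.mono ((hAm (n + 1)).pow_const 2).aestronglyMeasurable (ae_of_all _ fun ω => ?_)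
      rw [Real.norm_eq_abs, Real.norm_eq_abs, abs_of_nonneg (sq_nonneg _)]
      exact (hle ω).trans (le_abs_self _)
    refine ⟨(memLp_two_iff_integrable_sq (hAm (n + 1)).aestronglyMeasurable).2 hsq, ?_⟩
    calc _ ≤ ∫ ω, ((1 + q) * (A ω ^ 2 * R ω) + (1 + 1 / q) * X (n + 1) ω ^ 2) ∂μ :=
          integral_mono hsq hdom hle
      _ = (1 + q) * ((∫ ω, A ω ^ 2 ∂μ) * (1 - q)) + K := by
          rw [integral_add (hAR.const_mul _) ((hXsq (n + 1)).const_mul _), integral_const_mul,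
            integral_const_mul, hXint, hind.integral_fun_mul_eq_mul_integral
              ((hAm n).pow_const 2).aestronglyMeasurable hRmeas.aestronglyMeasurable, hRint]
      _ ≤ (1 + q) * (K / q ^ 2 * (1 - q)) + K := by
          have : 0 ≤ 1 - q := by linarith
          gcongr
      _ = K / q ^ 2 := by field_simp; ring

theorem ae_forall_pos_nonneg (hlam : 0 < lam) (hν : ∀ᵐ s ∂ν, 0 ≤ s)
    (hp : p ∈ stdSimplex ℝ (Fin M)) (h : IsInput μ lam ν p X S L) :
    ∀ᵐ ω ∂μ, (∀ n, 0 < X n ω) ∧ ∀ n, 0 ≤ S n ω := by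
  have h1 : ∀ n, ∀ᵐ ω ∂μ, 0 < X n ω ∧ 0 ≤ S n ω := fun n => by
    have hae := ae_prod_nonneg hlam hν hp
    rw [← (h.hasLaw n).map_eq] at hae
    exact ae_of_ae_map (h.hasLaw n).aemeasurable hae
  filter_upwards [ae_all_iff.2 h1] with ω hω
  exact ⟨fun n => (hω n).1, fun n => (hω n).2⟩

/-- The average ages of a stream with positive probability, for a measurable input. -/
theorem ae_hasAvgAge_of_measurable (hlam : 0 < lam) (hν : ∀ᵐ s ∂ν, 0 ≤ s)
    (hp : p ∈ stdSimplex ℝ (Fin M)) (h : IsInput μ lam ν p X S L)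
    (hX : ∀ n, Measurable (X n)) (hS : ∀ n, Measurable (S n)) (hL : ∀ n, Measurable (L n))
    {i : Fin M} (hi : 0 < p i) :
    ∀ᵐ ω ∂μ, HasAvgAge (X · ω) (S · ω) (L · ω) i
        (ENNReal.ofReal (1 / (lam * p i * ∫ s, Real.exp (-lam * s) ∂ν))) ∧
      HasAvgPeakAge (X · ω) (S · ω) (L · ω) i
        (ENNReal.ofReal (1 / (lam * p i * ∫ s, Real.exp (-lam * s) ∂ν) +
          (∫ s, s * Real.exp (-lam * s) ∂ν) / ∫ s, Real.exp (-lam * s) ∂ν)) := by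
  have := isProbabilityMeasure_expMeasure hlam
  have := isProbabilityMeasure_streamLaw hp
  set P := ∫ s, Real.exp (-lam * s) ∂ν with hP
  set E := ∫ s, s * Real.exp (-lam * s) ∂ν with hE
  have hP0 : 0 < P := integral_exp_neg_mul_pos hlam hν
  obtain ⟨B, hB⟩ := exists_bound_arrivalAge hlam hν hp h hX hS hL hi
  have l1 := ae_tendsto_average_mark hlam hp h hX hS hL (f := fun y => y.1 ^ 1) (by fun_prop)
    (memLp_fst_pow hlam hp 1) (integral_fst_pow hlam hp 1)
  have l2 := ae_tendsto_average_mark hlam hp h hX hS hL (f := fun y => y.1 ^ 2) (by fun_prop)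
    (memLp_fst_pow hlam hp 2) (integral_fst_pow hlam hp 2)
  have l3 := ae_tendsto_average_mark hlam hp h hX hS hL (measurable_success i)
    (memLp_success hlam hp i) (integral_success hlam hν hp i)
  have l4 := ae_tendsto_average_mark hlam hp h hX hS hL
    ((measurable_success i).mul (measurable_fst.comp measurable_snd))
    (memLp_success_mul_service hlam hν hp i) (integral_success_mul_service hlam hν hp i)
  have l5 := ae_tendsto_average_mul_mark hlam hp h hX hS hL (measurable_arrivalAge i)
    (fun n => (hB n).1) (fun n => (hB n).2) (measurable_success i)
    (memLp_success hlam hp i) (integral_success hlam hν hp i)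
  have l6 := ae_tendsto_average_mul_mark hlam hp h hX hS hL (measurable_arrivalAge i)
    (fun n => (hB n).1) (fun n => (hB n).2) (measurable_hold i)
    (memLp_hold hlam hν hp i) (integral_hold hlam hν hp i)
  -- Bounded second moments are summable against `1 / n ^ 2`, so `arrivalAge` is almost surely of
  -- smaller order than `n`. This removes the boundary term of the telescoped recursion.
  have l7 : ∀ᵐ ω ∂μ, Tendsto (fun n : ℕ =>
      arrivalAge (X · ω) (S · ω) (L · ω) i n ^ 2 / (n : ℝ) ^ 2) atTop (𝓝 0) := by
    refine ae_tendsto_zero_of_summable_integral (c := fun n : ℕ => B * (1 / (n : ℝ) ^ 2))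
      (fun n => (hB n).1.integrable_sq.div_const _) (fun n ω => by positivity) (fun n => ?_)
      ((Real.summable_one_div_nat_pow.2 one_lt_two).mul_left _)
    rw [integral_div, mul_one_div]
    exact div_le_div_of_nonneg_right (hB n).2 (sq_nonneg _)
  filter_upwards [ae_forall_pos_nonneg hlam hν hp h, l1, l2, l3, l4, l5, l6, l7]
    with ω ⟨hx, hs⟩ h1 h2 h3 h4 h5 h6 h7
  rw [← hP] at h3 h5 h6
  rw [← hE] at h4
  set x : ℕ → ℝ := fun n => X n ω
  set s : ℕ → ℝ := fun n => S n ω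
  set l : ℕ → Fin M := fun n => L n ω
  set a : ℕ → ℝ := arrivalAge x s l i with ha
  have hq0 : 0 < p i * P := mul_pos hi hP0
  have h1' : Tendsto (fun N : ℕ => (∑ n ∈ Finset.range N, x (n + 1)) / (N : ℝ)) atTop
      (𝓝 (1 / lam)) := by simpa [mark] using h1
  have h2' : Tendsto (fun N : ℕ => (∑ n ∈ Finset.range N, x (n + 1) ^ 2) / (N : ℝ)) atTop
      (𝓝 (2 / lam ^ 2)) := by simpa [mark] using h2
  have h7' : Tendsto (fun n : ℕ => a n / (n : ℝ)) atTop (𝓝 0) := by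
    have h := h7.sqrt
    rw [Real.sqrt_zero] at h
    refine h.congr fun n => ?_
    rw [← div_pow, Real.sqrt_sq (div_nonneg (arrivalAge_nonneg hx n) (Nat.cast_nonneg n))]
  have hx0 : Tendsto (fun N : ℕ => x 0 / (N : ℝ)) atTop (𝓝 0) :=
    tendsto_const_div_atTop_nhds_zero_nat (x 0)
  have hG : Tendsto (fun N : ℕ => genTime x N / (N : ℝ)) atTop (𝓝 (1 / lam)) := by
    have h := hx0.add h1'
    rw [zero_add] at h
    refine h.congr fun N => ?_
    rw [genTime, Finset.sum_range_succ', add_comm, add_div]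
  -- the recursion of the ages at the generation times, summed up
  have htel : ∀ N : ℕ, ∑ n ∈ Finset.range N, success i (mark x s l n) * a n =
      ∑ n ∈ Finset.range N, x (n + 1) - a N + x 0 := by
    intro N
    induction N with
    | zero => simp [ha, arrivalAge]
    | succ N ih =>
      rw [Finset.sum_range_succ, Finset.sum_range_succ, ih]
      have : a (N + 1) = (1 - success i (mark x s l N)) * a N + x (N + 1) := rfl
      rw [this]
      ring
  have hra : Tendsto (fun N : ℕ => (∑ n ∈ Finset.range N, success i (mark x s l n) * a n) /
      (N : ℝ)) atTop (𝓝 (1 / lam)) := by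
    have h := (h1'.sub h7').add hx0
    rw [sub_zero, add_zero] at h
    refine h.congr fun N => ?_
    rw [htel, add_div, sub_div]
  -- `hra` gives the average of success times age and `h5` allows success to be replaced by its mean
  -- `p i * P`; division by that mean leaves the average of the ages.
  have hmean : Tendsto (fun N : ℕ => (∑ n ∈ Finset.range N, a n) / (N : ℝ)) atTop
      (𝓝 (1 / (lam * (p i * P)))) := by
    have h := (hra.sub h5).div_const (p i * P)
    rw [sub_zero, div_div] at h
    refine h.congr fun N => ?_
    rw [← sub_div, ← Finset.sum_sub_distrib, div_right_comm, Finset.sum_div]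
    congr 1
    refine Finset.sum_congr rfl fun n _ => ?_
    field_simp
    ring
  constructor
  · have hv : Tendsto (fun N : ℕ => (∑ n ∈ Finset.range N,
        (x (n + 1) ^ 2 / 2 + arrivalAge x s l i n * hold i (mark x s l n))) / (N : ℝ)) atTop
        (𝓝 (1 / (lam * (p i * P)) / lam)) := by
      have h := (h2'.div_const 2).add (h6.add (hmean.mul_const ((1 - p i * P) / lam)))
      have hlim : 2 / lam ^ 2 / 2 + (0 + 1 / (lam * (p i * P)) * ((1 - p i * P) / lam)) =
          1 / (lam * (p i * P)) / lam := by
        field_simp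
        ring
      rw [hlim] at h
      refine h.congr fun N => ?_
      rw [Finset.sum_add_distrib, ← Finset.sum_div, add_div, div_right_comm]
      congr 1
      rw [div_mul_eq_mul_div, ← add_div, Finset.sum_mul, ← Finset.sum_add_distrib]
      congr 1
      refine Finset.sum_congr rfl fun n _ => ?_
      have : arrivalAge x s l i n = a n := rfl
      rw [this]
      ring
    have h := hasAvgAge_of_tendsto hx hs (by positivity) hG hv
    have e : 1 / (lam * (p i * P)) / lam / (1 / lam) = 1 / (lam * p i * P) := by field_simp
    rwa [e] at h
  · have hv : Tendsto (fun N : ℕ => (∑ n ∈ Finset.range N,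
        success i (mark x s l n) * (arrivalAge x s l i n + s n)) / (N : ℝ)) atTop
        (𝓝 (1 / lam + p i * E)) := by
      refine (hra.add h4).congr fun N => ?_
      rw [← add_div, ← Finset.sum_add_distrib]
      congr 1
      exact Finset.sum_congr rfl fun n _ => (mul_add _ _ _).symm
    have h := hasAvgPeakAge_of_tendsto hx hs hq0 h3 hv
    have e : (1 / lam + p i * E) / (p i * P) = 1 / (lam * p i * P) + E / P := by field_simp
    rwa [e] at h

theorem ae_received_eq_empty (hlam : 0 < lam) (hp : p ∈ stdSimplex ℝ (Fin M))
    (h : IsInput μ lam ν p X S L) {i : Fin M} (hi : p i = 0) :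
    ∀ᵐ ω ∂μ, received (X · ω) (S · ω) (L · ω) i = ∅ := by
  have := isProbabilityMeasure_expMeasure hlam
  have := isProbabilityMeasure_streamLaw hp
  have h1 : ∀ᵐ j ∂streamLaw p, j ≠ i := by
    rw [ae_iff]
    simp only [not_not]
    change streamLaw p {i} = 0
    rw [streamLaw_singleton, hi, ENNReal.ofReal_zero]
  have h2 : ∀ n, ∀ᵐ ω ∂μ, L n ω ≠ i := fun n => by
    have hlaw : HasLaw (L n) (streamLaw p) μ :=
      measurePreserving_snd.hasLaw.comp (hasLaw_service hlam hp h n)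
    rw [← hlaw.map_eq] at h1
    exact ae_of_ae_map hlaw.aemeasurable h1
  filter_upwards [ae_all_iff.2 h2] with ω hω
  exact Set.eq_empty_of_forall_notMem fun n hn => hω n hn.1

/-- An input agrees almost surely with a measurable one. -/
theorem exists_measurable_isInput (h : IsInput μ lam ν p X S L) :
    ∃ (X' S' : ℕ → Ω → ℝ) (L' : ℕ → Ω → Fin M), IsInput μ lam ν p X' S' L' ∧
      (∀ n, Measurable (X' n)) ∧ (∀ n, Measurable (S' n)) ∧ (∀ n, Measurable (L' n)) ∧
      ∀ᵐ ω ∂μ, (X · ω) = (X' · ω) ∧ (S · ω) = (S' · ω) ∧ (L · ω) = (L' · ω) := by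
  -- `HasLaw` gives only almost everywhere measurability, whereas the σ-algebras `past` require
  -- measurable functions. Countably many modifications share one null set.
  let Z : ℕ → Ω → ℝ × ℝ × Fin M := fun n => (h.hasLaw n).aemeasurable.mk _
  have hZ : ∀ n, Measurable (Z n) := fun n => (h.hasLaw n).aemeasurable.measurable_mk
  have hae : ∀ n, (fun ω => (X n ω, S n ω, L n ω)) =ᵐ[μ] Z n := fun n =>
    (h.hasLaw n).aemeasurable.ae_eq_mk
  refine ⟨fun n ω => (Z n ω).1, fun n ω => (Z n ω).2.1, fun n ω => (Z n ω).2.2,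
    ⟨fun n => (h.hasLaw n).congr (hae n).symm, h.indep.congr hae⟩,
    fun n => measurable_fst.comp (hZ n),
    fun n => (measurable_fst.comp measurable_snd).comp (hZ n),
    fun n => (measurable_snd.comp measurable_snd).comp (hZ n), ?_⟩
  filter_upwards [ae_all_iff.2 hae] with ω hω
  refine ⟨funext fun n => ?_, funext fun n => ?_, funext fun n => ?_⟩
  · exact congrArg Prod.fst (hω n)
  · exact congrArg (fun z => z.2.1) (hω n)
  · exact congrArg (fun z => z.2.2) (hω n)

end Limits

/-! ### Minimization over the simplex -/

section Minimization

variable {M : ℕ} {p : Fin M → ℝ} {c d : ℝ}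

/-- The average ages as functions of the probability `t` of a stream. -/
def streamCost (c d t : ℝ) : ℝ≥0∞ :=
  if 0 < t then ENNReal.ofReal (1 / (c * t) + d) else ∞

theorem uniform_mem_stdSimplex (hM : 0 < M) :
    (fun _ => 1 / (M : ℝ)) ∈ stdSimplex ℝ (Fin M) := by
  refine ⟨fun _ => by positivity, ?_⟩
  have : (M : ℝ) ≠ 0 := by positivity
  simp [this]

/-- Since `1 / t = (1 - M * t) ^ 2 / t + 2 * M - M ^ 2 * t` and the probabilities sum to one, the
excess over the uniform value is a sum of nonnegative terms that vanish only at `1 / M`. -/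
theorem sum_streamCost (hc : 0 < c) (hd : 0 ≤ d) (hp : p ∈ stdSimplex ℝ (Fin M))
    (hpos : ∀ i, 0 < p i) :
    ∑ i, streamCost c d (p i) = ENNReal.ofReal ((M : ℝ) ^ 2 / c + M * d +
      (∑ i, (1 - M * p i) ^ 2 / p i) / c) := by
  simp only [streamCost, hpos, if_true]
  rw [← ENNReal.ofReal_sum_of_nonneg fun i _ => by
    have := hpos i
    positivity]
  congr 1
  have hterm : ∀ i, (1 - M * p i) ^ 2 / p i = c * (1 / (c * p i)) - 2 * M + M ^ 2 * p i := by
    intro i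
    have := hpos i
    field_simp
    ring
  simp_rw [hterm]
  rw [Finset.sum_add_distrib, Finset.sum_add_distrib, Finset.sum_sub_distrib, ← Finset.mul_sum,
    ← Finset.mul_sum, ← Finset.mul_sum, hp.2]
  simp only [Finset.sum_const, Finset.card_univ, Fintype.card_fin, nsmul_eq_mul]
  generalize ∑ i, 1 / (c * p i) = T
  field_simp
  ring

theorem sum_streamCost_uniform (hM : 0 < M) (hc : 0 < c) (hd : 0 ≤ d) :
    ∑ _i : Fin M, streamCost c d (1 / (M : ℝ)) = ENNReal.ofReal ((M : ℝ) ^ 2 / c + M * d) := by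
  have hM' : (M : ℝ) ≠ 0 := by positivity
  rw [sum_streamCost hc hd (uniform_mem_stdSimplex hM) fun _ => by positivity]
  simp [hM']

theorem sum_streamCost_eq_top (hp : ∃ i, ¬ 0 < p i) : ∑ i, streamCost c d (p i) = ∞ := by
  obtain ⟨i, hi⟩ := hp
  exact ENNReal.sum_eq_top.2 ⟨i, Finset.mem_univ i, if_neg hi⟩

theorem isMinOn_sum_streamCost (hM : 0 < M) (hc : 0 < c) (hd : 0 ≤ d) :
    IsMinOn (fun p : Fin M → ℝ => ∑ i, streamCost c d (p i)) (stdSimplex ℝ (Fin M))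
      (fun _ => 1 / (M : ℝ)) := by
  refine isMinOn_iff.2 fun p hp => ?_
  rw [sum_streamCost_uniform hM hc hd]
  by_cases hpos : ∀ i, 0 < p i
  · rw [sum_streamCost hc hd hp hpos]
    refine ENNReal.ofReal_le_ofReal (le_add_of_nonneg_right ?_)
    exact div_nonneg (Finset.sum_nonneg fun i _ => div_nonneg (sq_nonneg _) (hpos i).le) hc.le
  · rw [sum_streamCost_eq_top (not_forall.1 hpos)]
    exact le_top

theorem eq_uniform_of_isMinOn_sum_streamCost (hM : 0 < M) (hc : 0 < c) (hd : 0 ≤ d)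
    (hp : p ∈ stdSimplex ℝ (Fin M))
    (hmin : IsMinOn (fun p : Fin M → ℝ => ∑ i, streamCost c d (p i)) (stdSimplex ℝ (Fin M)) p) :
    p = fun _ => 1 / (M : ℝ) := by
  have hle := isMinOn_iff.1 hmin _ (uniform_mem_stdSimplex hM)
  rw [sum_streamCost_uniform hM hc hd] at hle
  -- A vanishing probability makes the total infinite, while the uniform total is finite.
  have hpos : ∀ i, 0 < p i := by
    by_contra hcon
    rw [sum_streamCost_eq_top (not_forall.1 hcon)] at hle
    exact ENNReal.ofReal_ne_top (top_le_iff.1 hle)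
  rw [sum_streamCost hc hd hp hpos, ENNReal.ofReal_le_ofReal_iff (by positivity)] at hle
  have hnn : ∀ i ∈ Finset.univ, 0 ≤ (1 - M * p i) ^ 2 / p i := fun i _ =>
    div_nonneg (sq_nonneg _) (hpos i).le
  have hzero : ∑ i, (1 - M * p i) ^ 2 / p i = 0 := by
    refine le_antisymm ?_ (Finset.sum_nonneg hnn)
    by_contra! hlt
    linarith [div_pos hlt hc]
  funext i
  have hi := (Finset.sum_eq_zero_iff_of_nonneg hnn).1 hzero i (Finset.mem_univ i)
  rw [div_eq_zero_iff, or_iff_left (hpos i).ne', sq_eq_zero_iff, sub_eq_zero] at hi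
  have hM' : (M : ℝ) ≠ 0 := by positivity
  rw [eq_div_iff hM', mul_comm]
  exact hi.symm

end Minimization

/-! ### Assembly for arbitrary probability vectors and inputs -/

/-- The average ages of every stream. -/
theorem ae_hasAvgAge {M : ℕ} {lam : ℝ} {ν : Measure ℝ} [IsProbabilityMeasure ν] {p : Fin M → ℝ}
    {Ω : Type*} [MeasurableSpace Ω] {μ : Measure Ω} [IsProbabilityMeasure μ]
    {X S : ℕ → Ω → ℝ} {L : ℕ → Ω → Fin M} (hlam : 0 < lam) (hν : ∀ᵐ s ∂ν, 0 ≤ s)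
    (hp : p ∈ stdSimplex ℝ (Fin M)) (h : IsInput μ lam ν p X S L) (i : Fin M) :
    ∀ᵐ ω ∂μ, HasAvgAge (X · ω) (S · ω) (L · ω) i
        (streamCost (lam * ∫ s, Real.exp (-lam * s) ∂ν) 0 (p i)) ∧
      HasAvgPeakAge (X · ω) (S · ω) (L · ω) i
        (streamCost (lam * ∫ s, Real.exp (-lam * s) ∂ν)
          ((∫ s, s * Real.exp (-lam * s) ∂ν) / ∫ s, Real.exp (-lam * s) ∂ν) (p i)) := by
  by_cases hi : 0 < p i
  · obtain ⟨X', S', L', h', hX, hS, hL, hae⟩ := exists_measurable_isInput h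
    filter_upwards [hae, ae_hasAvgAge_of_measurable hlam hν hp h' hX hS hL hi]
      with ω ⟨e1, e2, e3⟩ hω
    rw [e1, e2, e3, streamCost, streamCost, if_pos hi, if_pos hi, add_zero, mul_right_comm]
    exact hω
  · have hi0 : p i = 0 := le_antisymm (not_lt.1 hi) (hp.1 i)
    filter_upwards [ae_received_eq_empty hlam hp h hi0] with ω hω
    rw [streamCost, streamCost, if_neg hi, if_neg hi]
    exact ⟨hasAvgAge_top_of_received_eq_empty hω, hasAvgPeakAge_top_of_received_eq_empty hω⟩

end PreemptiveQueue

end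

theorem mainTheorem2 (M : ℕ) (hM : 0 < M) (lam : ℝ) (hlam : 0 < lam)
    (ν : Measure ℝ) [IsProbabilityMeasure ν] (hν : ∀ᵐ s ∂ν, 0 ≤ s) :
    -- the average ages `Δ p i` and the average peak ages `Δpeak p i`
    ∃ Δ Δpeak : (Fin M → ℝ) → Fin M → ℝ≥0∞,
      (∀ p ∈ stdSimplex ℝ (Fin M), ∀ (Ω : Type*) [MeasurableSpace Ω] (μ : Measure Ω)
        [IsProbabilityMeasure μ] (X S : ℕ → Ω → ℝ) (L : ℕ → Ω → Fin M),
        PreemptiveQueue.IsInput μ lam ν p X S L → ∀ i : Fin M, ∀ᵐ ω ∂μ,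
          PreemptiveQueue.HasAvgAge (fun n => X n ω) (fun n => S n ω) (fun n => L n ω) i (Δ p i) ∧
          PreemptiveQueue.HasAvgPeakAge (fun n => X n ω) (fun n => S n ω) (fun n => L n ω) i (Δpeak p i)) ∧
      -- the uniform distribution is the unique minimizer of both totals
      IsMinOn (fun p => ∑ i, Δ p i) (stdSimplex ℝ (Fin M)) (fun _ => 1 / (M : ℝ)) ∧
      IsMinOn (fun p => ∑ i, Δpeak p i) (stdSimplex ℝ (Fin M)) (fun _ => 1 / (M : ℝ)) ∧
      (∀ p ∈ stdSimplex ℝ (Fin M),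
        IsMinOn (fun q => ∑ i, Δ q i) (stdSimplex ℝ (Fin M)) p → p = fun _ => 1 / (M : ℝ)) ∧
      (∀ p ∈ stdSimplex ℝ (Fin M),
        IsMinOn (fun q => ∑ i, Δpeak q i) (stdSimplex ℝ (Fin M)) p → p = fun _ => 1 / (M : ℝ)) ∧
      -- the minimal values
      ∑ i, Δ (fun _ => 1 / (M : ℝ)) i =
        ENNReal.ofReal ((M : ℝ) ^ 2 / (lam * ∫ s, Real.exp (-lam * s) ∂ν)) ∧
      ∑ i, Δpeak (fun _ => 1 / (M : ℝ)) i =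
        ENNReal.ofReal ((M : ℝ) ^ 2 / (lam * ∫ s, Real.exp (-lam * s) ∂ν) +
          M * (∫ s, s * Real.exp (-lam * s) ∂ν) / ∫ s, Real.exp (-lam * s) ∂ν) := by
  set P := ∫ s, Real.exp (-lam * s) ∂ν with hP
  set E := ∫ s, s * Real.exp (-lam * s) ∂ν with hE
  have hP0 : 0 < P := PreemptiveQueue.integral_exp_neg_mul_pos hlam hν
  have hE0 : 0 ≤ E := integral_nonneg_of_ae
    (hν.mono fun s hs => mul_nonneg hs (Real.exp_pos _).le)
  have hc : 0 < lam * P := mul_pos hlam hP0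
  have hd : 0 ≤ E / P := div_nonneg hE0 hP0.le
  -- The totals differ only in the additive constant per stream: 0 for the age, and for the peak age
  -- `E / P`, the mean service time of a received update.
  refine ⟨fun p i => PreemptiveQueue.streamCost (lam * P) 0 (p i),
    fun p i => PreemptiveQueue.streamCost (lam * P) (E / P) (p i), ?_,
    PreemptiveQueue.isMinOn_sum_streamCost hM hc le_rfl,
    PreemptiveQueue.isMinOn_sum_streamCost hM hc hd,
    fun p hp hmin => PreemptiveQueue.eq_uniform_of_isMinOn_sum_streamCost hM hc le_rfl hp hmin,
    fun p hp hmin => PreemptiveQueue.eq_uniform_of_isMinOn_sum_streamCost hM hc hd hp hmin, ?_, ?_⟩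
  · intro p hp Ω _ μ _ X S L h i
    exact PreemptiveQueue.ae_hasAvgAge hlam hν hp h i
  · rw [PreemptiveQueue.sum_streamCost_uniform hM hc le_rfl, mul_zero, add_zero]
  · rw [PreemptiveQueue.sum_streamCost_uniform hM hc hd, mul_div_assoc]
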